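/- Let $(\Omega,\mathcal F,\mathbb P)$ be a probability space and let $W=(W(t,A))$, $t\ge 0$, $A\subset\mathbb R$ bounded Borel, be a space-time white noise on it, i.e. a centered Gaussian process with $\mathbb E[W(t,A)W(t',A')]=(t\wedge t')\,\lambda(A\cap A')$, where $\lambda$ is Lebesgue measure. Put $G(t,x)=(2\pi t)^{-1/2}e^{-x^2/(2t)}$ for $t>0$ and $G(t,x)=0$ for $t\le 0$. Let $T>0$ and let $u=(u(t,x))_{t\in[0,T],\,x\in\mathbb R}$ be a version of the mild solution $$u(t,x)=\int_0^t\int_{\mathbb R}G(t-s,x-y)\,dW(s,y)$$ (Wiener integral) of the stochastic heat equation $\partial_t u=\tfrac12\Delta u+\frac{\partial^2}{\partial t\,\partial x}W$, $u(0,\cdot)=0$, such that for each $t$ the map $(x,\omega)\mapsto u(t,x)(\omega)$ is measurable with respect to the completion of $\lambda\otimes\mathbb P$ (for example, a version that is continuous in $x$). For $1\le p<\infty$, $0<\alpha<1$, $I=[0,1]$ and $f\in L^p(I)$ let $$\Delta_p(f)(h)=\sup_{|s|\le h}\Big(\int_{\{x\in I:\,x+s\in I\}}|f(x+s)-f(x)|^p\,dx\Big)^{1/p},$$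 $$\mathcal B^{\alpha}_p=\Big\{f\in L^p(I):\ \|f\|_{L^p(I)}+\sup_{0<h\le 1}h^{-\alpha}\Delta_p(f)(h)<\infty\Big\},\qquad \mathcal B^{\alpha,0}_p=\big\{f\in L^p(I):\ \Delta_p(f)(h)=o(h^{\alpha})\text{ as }h\to0^+\big\}.$$ Then for all $t\in(0,T]$ and all $2<p<\infty$, $$\mathbb P\big[u(t,\cdot)\in\mathcal B^{1/2}_p\big]=1\quad\text{and}\quad \mathbb P\big[u(t,\cdot)\in\mathcal B^{1/2,0}_p\big]=0,$$ where $u(t,\cdot)$ is the sample path $x\in[0,1]\mapsto u(t,x)$. -/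

import Mathlib

open MeasureTheory ProbabilityTheory Filter Topology Set
open scoped NNReal ENNReal

noncomputable section

namespace StochHeat

/-- The bounded Borel subsets of the real line. -/
abbrev BoundedBorel : Type := {A : Set ℝ // MeasurableSet A ∧ Bornology.IsBounded A}

variable {Ω : Type*} [MeasurableSpace Ω]

/-- Space-time white noise: a centered Gaussian process `W(t, A)`, indexed by times `t ≥ 0` and
bounded Borel sets `A`, with covariance `E[W(t, A) W(t', A')] = (t ∧ t') λ(A ∩ A')`. -/
structure IsWhiteNoise (W : ℝ≥0 × BoundedBorel → Ω → ℝ) (P : Measure Ω) : Prop where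
  isGaussianProcess : IsGaussianProcess W P
  centered : ∀ i, ∫ ω, W i ω ∂P = 0
  covariance : ∀ i j, ∫ ω, W i ω * W j ω ∂P =
    ((min i.1 j.1 : ℝ≥0) : ℝ) * volume.real ((i.2 : Set ℝ) ∩ (j.2 : Set ℝ))

/-- The elementary integrand `∑ cᵢ 1_{(0, tᵢ] × Aᵢ}`, a function of `(s, y)`. -/
def elemFun (c : (ℝ≥0 × BoundedBorel) →₀ ℝ) (q : ℝ × ℝ) : ℝ :=
  c.sum fun i a => a * (Ioc (0 : ℝ) i.1 ×ˢ (i.2 : Set ℝ)).indicator 1 q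

/-- The integral `∑ cᵢ W(tᵢ, Aᵢ)` of the elementary integrand `∑ cᵢ 1_{(0, tᵢ] × Aᵢ}`. -/
def elemIntegral (W : ℝ≥0 × BoundedBorel → Ω → ℝ) (c : (ℝ≥0 × BoundedBorel) →₀ ℝ) (ω : Ω) : ℝ :=
  c.sum fun i a => a * W i ω

/-- `Y` is (a version of) the Wiener integral `∫ h dW` of the deterministic square integrable
function `h`: the `L²(P)`-limit of the integrals of elementary integrands that converge to `h` in
`L²(ds dy)`. By the isometry property of the integral this determines `Y` almost surely. -/
def IsWienerIntegral (W : ℝ≥0 × BoundedBorel → Ω → ℝ) (P : Measure Ω)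
    (h : ℝ × ℝ → ℝ) (Y : Ω → ℝ) : Prop :=
  MemLp h 2 volume ∧ MemLp Y 2 P ∧
    ∃ c : ℕ → ((ℝ≥0 × BoundedBorel) →₀ ℝ),
      Tendsto (fun n => eLpNorm (fun q => elemFun (c n) q - h q) 2 volume) atTop (𝓝 0) ∧
      Tendsto (fun n => eLpNorm (fun ω => elemIntegral W (c n) ω - Y ω) 2 P) atTop (𝓝 0)

/-- The Green kernel of `∂ₜ - ½ ∂ₓₓ`. -/
def green (t x : ℝ) : ℝ :=
  if 0 < t then (Real.sqrt (2 * Real.pi * t))⁻¹ * Real.exp (-(x ^ 2) / (2 * t)) else 0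

/-- The integrand `(s, y) ↦ 1_{0 < s ≤ t} G(t - s, x - y)` of the mild solution. -/
def mildKernel (t x : ℝ) (q : ℝ × ℝ) : ℝ :=
  (Ioc (0 : ℝ) t ×ˢ (univ : Set ℝ)).indicator (fun r => green (t - r.1) (x - r.2)) q

/-- `u` is (a version of) the mild solution on `[0, T] × ℝ` of the stochastic heat equation
`∂ₜ u = ½ ∂ₓₓ u + Ẇ`, `u(0, ·) = 0`: `u(t, x) = ∫₀ᵗ ∫ G(t - s, x - y) dW(s, y)` almost surely for
all `(t, x)`, and at each time `u` is measurable in `(x, ω)`, up to a null set. The measurability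
holds in particular if almost all the paths `x ↦ u(t, x)` are continuous. -/
structure IsMildSolution (W : ℝ≥0 × BoundedBorel → Ω → ℝ) (P : Measure Ω) (T : ℝ)
    (u : ℝ → ℝ → Ω → ℝ) : Prop where
  isWienerIntegral : ∀ t ∈ Icc 0 T, ∀ x, IsWienerIntegral W P (mildKernel t x) (u t x)
  aemeasurable : ∀ t ∈ Icc 0 T, AEMeasurable (fun q : ℝ × Ω => u t q.1 q.2) (volume.prod P)

/-- The modulus of continuity
`Δ_p(f, I)(t) = sup_{|s| ≤ t} (∫_{I_s} |f (x + s) - f x| ^ p dx) ^ (1 / p)`, where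
`I_s = {x ∈ I | x + s ∈ I}`. -/
def lpModulus (p : ℝ≥0∞) (I : Set ℝ) (f : ℝ → ℝ) (t : ℝ) : ℝ≥0∞ :=
  ⨆ (s : ℝ) (_ : |s| ≤ t),
    eLpNorm (fun x => f (x + s) - f x) p (volume.restrict {x | x ∈ I ∧ x + s ∈ I})

/-- The Besov norm `‖f‖_{L^p(I)} + sup_{0 < t ≤ 1} Δ_p(f, I)(t) / t ^ α`. -/
def besovNorm (α : ℝ) (p : ℝ≥0∞) (I : Set ℝ) (f : ℝ → ℝ) : ℝ≥0∞ :=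
  eLpNorm f p (volume.restrict I) +
    ⨆ (t : ℝ) (_ : t ∈ Ioc (0 : ℝ) 1), lpModulus p I f t / ENNReal.ofReal (t ^ α)

/-- The Besov space `B^α_p(I)`. Only the values of `f` on `I` matter. -/
def besov (α : ℝ) (p : ℝ≥0∞) (I : Set ℝ) : Set (ℝ → ℝ) :=
  {f | MemLp f p (volume.restrict I) ∧ besovNorm α p I f < ∞}

/-- The little Besov space `B^{α,0}_p(I)`: the functions in `L^p(I)` with
`Δ_p(f, I)(t) = o(t ^ α)` as `t → 0+`. -/
def littleBesov (α : ℝ) (p : ℝ≥0∞) (I : Set ℝ) : Set (ℝ → ℝ) :=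
  {f | MemLp f p (volume.restrict I) ∧
    Tendsto (fun t : ℝ => lpModulus p I f t / ENNReal.ofReal (t ^ α)) (𝓝[>] 0) (𝓝 0)}

end StochHeat

end

/-! At a fixed time t the field x ↦ u(t, x) is a centered Gaussian process whose covariance depends
only on z = x - y and equals R(z) = ∫₀ᵗ G(2v, z) dv. This even function has a bounded second
derivative away from 0 and a corner at 0, with one-sided slopes ∓1/2. Hence the increments over a
step s have variance s + O(s²), while two increments based at points at distance at least s have
covariance O(s²), a second difference of R (`exists_incrementCov_bound`). On small scales the path
therefore looks like Brownian motion.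

Let m be the p-th absolute moment of the standard normal law, and consider the integral over x of
the p-th power of the normalized increments. It has mean (1 - s) m. Its variance is O(s), because
the covariance of |X|^p and |Y|^p is bounded by the correlation of the Gaussian variables X and Y
(`abs_integral_centered_mul_le`, `integral_sq_centered_power_variation_le`). Along s = 2⁻ⁿ these
variances are summable, so the integral converges almost surely to m, which is positive and finite.

Thus almost every path has L^p increments of exact order s^(1/2) over dyadic steps
(`ae_exists_dyadic_bounds`). The upper bound extends to all steps by the triangle inequality along
binary expansions (`mem_besov_of_dyadic`); the lower bound already excludes o(s^(1/2))
(`notMem_littleBesov_of_dyadic`). -/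

namespace StochHeat

/-! ### Wiener integrals: Gaussian law, isometry, independence. -/

section WienerIntegral

section L2

variable {α : Type*} [MeasurableSpace α] {μ : Measure α}

lemma toReal_eLpNorm_two_sq {f : α → ℝ} (hf : MemLp f 2 μ) :
    (eLpNorm f 2 μ).toReal ^ 2 = ∫ x, f x ^ 2 ∂μ := by
  rw [hf.eLpNorm_eq_integral_rpow_norm (by simp) (by simp), ENNReal.toReal_ofReal (by positivity)]
  have h0 : (0 : ℝ) ≤ ∫ x, f x ^ 2 ∂μ := integral_nonneg fun x => by positivity
  simp only [ENNReal.toReal_ofNat, Real.rpow_ofNat, Real.norm_eq_abs, sq_abs]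
  rw [← Real.rpow_natCast, ← Real.rpow_mul h0]
  norm_num

lemma tendsto_integral_sq {f : ℕ → α → ℝ} {g : α → ℝ} (hf : ∀ n, MemLp (f n) 2 μ)
    (hg : MemLp g 2 μ) (h : Tendsto (fun n => eLpNorm (fun x => f n x - g x) 2 μ) atTop (𝓝 0)) :
    Tendsto (fun n => ∫ x, f n x ^ 2 ∂μ) atTop (𝓝 (∫ x, g x ^ 2 ∂μ)) := by
  have h1 : Tendsto (fun n => (hf n).toLp (f n)) atTop (𝓝 (hg.toLp g)) :=
    (Lp.tendsto_Lp_iff_tendsto_eLpNorm'' f hf g hg).2 h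
  have h2 := (h1.norm).pow 2
  simp only [Lp.norm_toLp] at h2
  rw [toReal_eLpNorm_two_sq hg] at h2
  exact h2.congr fun n => toReal_eLpNorm_two_sq (hf n)

lemma integral_sum_mul_sq {ι : Type*} (s : Finset ι) (c : ι → ℝ) {f : ι → α → ℝ}
    (hf : ∀ i, MemLp (f i) 2 μ) :
    ∫ x, (∑ i ∈ s, c i * f i x) ^ 2 ∂μ =
      ∑ i ∈ s, ∑ j ∈ s, c i * c j * ∫ x, f i x * f j x ∂μ := by
  have h1 : ∀ i j, Integrable (fun x => c i * c j * (f i x * f j x)) μ :=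
    fun i j => ((hf i).integrable_mul (hf j)).const_mul _
  have h2 : ∀ x, (∑ i ∈ s, c i * f i x) ^ 2 =
      ∑ i ∈ s, ∑ j ∈ s, c i * c j * (f i x * f j x) := by
    intro x
    rw [sq, Finset.sum_mul_sum]
    exact Finset.sum_congr rfl fun i _ => Finset.sum_congr rfl fun j _ => by ring
  simp only [h2]
  rw [integral_finsetSum _ fun i _ => integrable_finsetSum _ fun j _ => h1 i j]
  refine Finset.sum_congr rfl fun i _ => ?_
  rw [integral_finsetSum _ fun j _ => h1 i j]
  exact Finset.sum_congr rfl fun j _ => integral_const_mul _ _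

lemma integral_add_sq {f g : α → ℝ} (hf : MemLp f 2 μ) (hg : MemLp g 2 μ) :
    ∫ x, (f x + g x) ^ 2 ∂μ =
      (∫ x, f x ^ 2 ∂μ) + 2 * (∫ x, f x * g x ∂μ) + ∫ x, g x ^ 2 ∂μ := by
  have h1 : Integrable (fun x => 2 * (f x * g x)) μ := (hf.integrable_mul hg).const_mul 2
  rw [← integral_const_mul, ← integral_add hf.integrable_sq h1,
    ← integral_add (f := fun x => f x ^ 2 + 2 * (f x * g x)) (hf.integrable_sq.add h1)
      hg.integrable_sq]
  exact integral_congr_ae (ae_of_all _ fun x => by simp only; ring)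

lemma tendsto_eLpNorm_linear_comb_sub {f g : ℕ → α → ℝ} {f' g' : α → ℝ} (a b : ℝ)
    (hf : ∀ n, MemLp (f n) 2 μ) (hg : ∀ n, MemLp (g n) 2 μ) (hf' : MemLp f' 2 μ)
    (hg' : MemLp g' 2 μ)
    (h1 : Tendsto (fun n => eLpNorm (fun x => f n x - f' x) 2 μ) atTop (𝓝 0))
    (h2 : Tendsto (fun n => eLpNorm (fun x => g n x - g' x) 2 μ) atTop (𝓝 0)) :
    Tendsto (fun n => eLpNorm (fun x => a * f n x + b * g n x - (a * f' x + b * g' x)) 2 μ)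
      atTop (𝓝 0) := by
  have h3 := (ENNReal.Tendsto.const_mul (a := ‖a‖ₑ) h1 (Or.inr (by simp))).add
    (ENNReal.Tendsto.const_mul (a := ‖b‖ₑ) h2 (Or.inr (by simp)))
  rw [mul_zero, mul_zero, add_zero] at h3
  refine tendsto_of_tendsto_of_tendsto_of_le_of_le tendsto_const_nhds h3 (fun n => zero_le)
    fun n => ?_
  have e : (fun x => a * f n x + b * g n x - (a * f' x + b * g' x)) =
      (a • fun x => f n x - f' x) + b • fun x => g n x - g' x := by
    ext x; simp; ring
  simp only [e]
  refine (eLpNorm_add_le (((hf n).1.sub hf'.1).const_smul a) (((hg n).1.sub hg'.1).const_smul b)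
    (by norm_num)).trans (le_of_eq ?_)
  rw [eLpNorm_const_smul, eLpNorm_const_smul]
  rfl

end L2

variable {Ω : Type*} {W : ℝ≥0 × BoundedBorel → Ω → ℝ}

/-- The box `(0, t] × A` whose noise is `W (t, A)`. -/
def box (i : ℝ≥0 × BoundedBorel) : Set (ℝ × ℝ) := Ioc (0 : ℝ) i.1 ×ˢ (i.2 : Set ℝ)

lemma measurableSet_box (i : ℝ≥0 × BoundedBorel) : MeasurableSet (box i) :=
  measurableSet_Ioc.prod i.2.2.1

lemma volume_box_ne_top (i : ℝ≥0 × BoundedBorel) : volume (box i) ≠ ∞ := by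
  rw [box, Measure.volume_eq_prod, Measure.prod_prod]
  exact ENNReal.mul_ne_top (by simp) i.2.2.2.measure_lt_top.ne

lemma memLp_indicator_box (i : ℝ≥0 × BoundedBorel) :
    MemLp ((box i).indicator (1 : ℝ × ℝ → ℝ)) 2 volume :=
  memLp_indicator_const 2 (measurableSet_box i) 1 (Or.inr (volume_box_ne_top i))

lemma integral_indicator_box_mul (i j : ℝ≥0 × BoundedBorel) :
    ∫ q, (box i).indicator (1 : ℝ × ℝ → ℝ) q * (box j).indicator (1 : ℝ × ℝ → ℝ) q =
      ((min i.1 j.1 : ℝ≥0) : ℝ) * volume.real ((i.2 : Set ℝ) ∩ (j.2 : Set ℝ)) := by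
  have h : (fun q => (box i).indicator (1 : ℝ × ℝ → ℝ) q * (box j).indicator (1 : ℝ × ℝ → ℝ) q) =
      (box i ∩ box j).indicator 1 := by
    ext q
    by_cases h1 : q ∈ box i <;> by_cases h2 : q ∈ box j <;> simp [h1, h2]
  rw [h, integral_indicator_one ((measurableSet_box i).inter (measurableSet_box j)), box, box,
    prod_inter_prod, Ioc_inter_Ioc, Measure.volume_eq_prod, measureReal_prod_prod]
  simp

lemma elemFun_eq_sum (c : (ℝ≥0 × BoundedBorel) →₀ ℝ) (q : ℝ × ℝ) :
    elemFun c q = ∑ i ∈ c.support, c i * (box i).indicator 1 q := rfl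

lemma elemIntegral_eq_sum (c : (ℝ≥0 × BoundedBorel) →₀ ℝ) (ω : Ω) :
    elemIntegral W c ω = ∑ i ∈ c.support, c i * W i ω := rfl

lemma elemFun_add (c d : (ℝ≥0 × BoundedBorel) →₀ ℝ) (q : ℝ × ℝ) :
    elemFun (c + d) q = elemFun c q + elemFun d q :=
  Finsupp.sum_add_index' (by simp) (by intros; ring)

lemma elemFun_smul (a : ℝ) (c : (ℝ≥0 × BoundedBorel) →₀ ℝ) (q : ℝ × ℝ) :
    elemFun (a • c) q = a * elemFun c q := by
  rw [elemFun, Finsupp.sum_smul_index (by simp), elemFun, Finsupp.mul_sum]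
  simp only [mul_assoc]

lemma elemIntegral_add (c d : (ℝ≥0 × BoundedBorel) →₀ ℝ) (ω : Ω) :
    elemIntegral W (c + d) ω = elemIntegral W c ω + elemIntegral W d ω :=
  Finsupp.sum_add_index' (by simp) (by intros; ring)

lemma elemIntegral_smul (a : ℝ) (c : (ℝ≥0 × BoundedBorel) →₀ ℝ) (ω : Ω) :
    elemIntegral W (a • c) ω = a * elemIntegral W c ω := by
  rw [elemIntegral, Finsupp.sum_smul_index (by simp), elemIntegral, Finsupp.mul_sum]
  simp only [mul_assoc]

variable [MeasurableSpace Ω] {P : Measure Ω}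

lemma memLp_elemFun (c : (ℝ≥0 × BoundedBorel) →₀ ℝ) : MemLp (elemFun c) 2 volume :=
  memLp_finsetSum (s := c.support) (f := fun i q => c i * (box i).indicator (1 : ℝ × ℝ → ℝ) q)
    fun i _ => (memLp_indicator_box i).const_mul (c i)

lemma IsWhiteNoise.memLp (hW : IsWhiteNoise W P) (i : ℝ≥0 × BoundedBorel) : MemLp (W i) 2 P :=
  (hW.isGaussianProcess.hasGaussianLaw_eval i).memLp_two

lemma IsWhiteNoise.memLp_elemIntegral (hW : IsWhiteNoise W P) (c : (ℝ≥0 × BoundedBorel) →₀ ℝ) :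
    MemLp (elemIntegral W c) 2 P :=
  memLp_finsetSum (s := c.support) (f := fun i ω => c i * W i ω)
    fun i _ => (hW.memLp i).const_mul (c i)

lemma IsWhiteNoise.hasGaussianLaw_elemIntegral (hW : IsWhiteNoise W P)
    (c : (ℝ≥0 × BoundedBorel) →₀ ℝ) : HasGaussianLaw (elemIntegral W c) P :=
  (hW.isGaussianProcess.smul c).hasGaussianLaw_fun_sum (I := c.support)

lemma IsWhiteNoise.integral_elemIntegral (hW : IsWhiteNoise W P)
    (c : (ℝ≥0 × BoundedBorel) →₀ ℝ) : ∫ ω, elemIntegral W c ω ∂P = 0 := by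
  have := hW.isGaussianProcess.isProbabilityMeasure
  simp only [elemIntegral_eq_sum]
  rw [integral_finsetSum _ fun i _ => ((hW.memLp i).integrable (by norm_num)).const_mul _]
  simp [integral_const_mul, hW.centered]

/-- The isometry property on elementary integrands. -/
lemma IsWhiteNoise.integral_elemIntegral_sq (hW : IsWhiteNoise W P)
    (c : (ℝ≥0 × BoundedBorel) →₀ ℝ) :
    ∫ ω, elemIntegral W c ω ^ 2 ∂P = ∫ q, elemFun c q ^ 2 := by
  simp only [elemIntegral_eq_sum, elemFun_eq_sum]
  rw [integral_sum_mul_sq _ _ hW.memLp, integral_sum_mul_sq _ _ memLp_indicator_box]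
  simp only [hW.covariance, integral_indicator_box_mul]

lemma IsWhiteNoise.map_elemIntegral (hW : IsWhiteNoise W P) (c : (ℝ≥0 × BoundedBorel) →₀ ℝ) :
    P.map (elemIntegral W c) = gaussianReal 0 (∫ q, elemFun c q ^ 2).toNNReal := by
  have h := hW.hasGaussianLaw_elemIntegral c
  rw [h.map_eq_gaussianReal, hW.integral_elemIntegral,
    variance_of_integral_eq_zero h.aemeasurable (hW.integral_elemIntegral c),
    ← hW.integral_elemIntegral_sq]

/-- The Wiener integral of `h` has the centered normal law of variance `∫ h ^ 2`. -/
theorem IsWienerIntegral.map_eq (hW : IsWhiteNoise W P) {h : ℝ × ℝ → ℝ} {Y : Ω → ℝ}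
    (hY : IsWienerIntegral W P h Y) : P.map Y = gaussianReal 0 (∫ q, h q ^ 2).toNNReal := by
  have := hW.isGaussianProcess.isProbabilityMeasure
  obtain ⟨hh, hY2, c, hc1, hc2⟩ := hY
  have h1 : TendstoInDistribution (fun n => elemIntegral W (c n)) atTop Y (fun _ => P) P :=
    (tendstoInMeasure_of_tendsto_eLpNorm (p := 2) two_ne_zero
      (fun n => (hW.memLp_elemIntegral (c n)).1) hY2.1 hc2).tendstoInDistribution
      fun n => (hW.memLp_elemIntegral (c n)).1.aemeasurable
  have h2 := ProbabilityMeasure.tendsto_iff_tendsto_charFun.1 h1.tendsto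
  have := Measure.isProbabilityMeasure_map (μ := P) hY2.1.aemeasurable
  refine Measure.ext_of_charFun (funext fun a => ?_)
  -- The elementary integrals are centered Gaussian with variances given by the isometry. These
  -- variances converge to ∫ h², which determines the limit of the characteristic functions.
  refine tendsto_nhds_unique (h2 a) ?_
  simp only [ProbabilityMeasure.coe_mk, hW.map_elemIntegral, charFun_gaussianReal]
  have h3 := tendsto_integral_sq (fun n => memLp_elemFun (c n)) hh hc1
  have h4 : Tendsto (fun n => (((∫ q, elemFun (c n) q ^ 2).toNNReal : ℝ≥0) : ℂ)) atTop
      (𝓝 (((∫ q, h q ^ 2).toNNReal : ℝ≥0) : ℂ)) := by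
    have := (Complex.continuous_ofReal.tendsto _).comp
      ((NNReal.continuous_coe.tendsto _).comp ((continuous_real_toNNReal.tendsto _).comp h3))
    exact this
  exact (Complex.continuous_exp.tendsto _).comp
    (tendsto_const_nhds.sub ((h4.mul_const _).div_const _))

lemma IsWienerIntegral.add_smul (hW : IsWhiteNoise W P) {h k : ℝ × ℝ → ℝ} {X Y : Ω → ℝ}
    (hX : IsWienerIntegral W P h X) (hY : IsWienerIntegral W P k Y) (a b : ℝ) :
    IsWienerIntegral W P (fun q => a * h q + b * k q) (fun ω => a * X ω + b * Y ω) := by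
  obtain ⟨hh, hX2, c, hc1, hc2⟩ := hX
  obtain ⟨hk, hY2, d, hd1, hd2⟩ := hY
  refine ⟨(hh.const_mul a).add (hk.const_mul b), (hX2.const_mul a).add (hY2.const_mul b),
    fun n => a • c n + b • d n, ?_, ?_⟩
  · simp only [elemFun_add, elemFun_smul]
    exact tendsto_eLpNorm_linear_comb_sub a b
      (fun n => memLp_elemFun _) (fun n => memLp_elemFun _) hh hk hc1 hd1
  · simp only [elemIntegral_add, elemIntegral_smul]
    exact tendsto_eLpNorm_linear_comb_sub a b
      (fun n => hW.memLp_elemIntegral _) (fun n => hW.memLp_elemIntegral _) hX2 hY2 hc2 hd2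

lemma IsWienerIntegral.integral_eq_zero (hW : IsWhiteNoise W P) {h : ℝ × ℝ → ℝ} {Y : Ω → ℝ}
    (hY : IsWienerIntegral W P h Y) : ∫ ω, Y ω ∂P = 0 := by
  have h1 := integral_map (f := fun x : ℝ => x) hY.2.1.1.aemeasurable
    (aestronglyMeasurable_id)
  rw [hY.map_eq hW, integral_id_gaussianReal] at h1
  exact h1.symm

lemma IsWienerIntegral.integral_sq (hW : IsWhiteNoise W P) {h : ℝ × ℝ → ℝ} {Y : Ω → ℝ}
    (hY : IsWienerIntegral W P h Y) : ∫ ω, Y ω ^ 2 ∂P = ∫ q, h q ^ 2 := by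
  rw [← variance_of_integral_eq_zero hY.2.1.1.aemeasurable (hY.integral_eq_zero hW)]
  have h1 := variance_map (X := fun x : ℝ => x) (Y := Y) (μ := P) aemeasurable_id
    hY.2.1.1.aemeasurable
  rw [hY.map_eq hW, variance_fun_id_gaussianReal] at h1
  rw [show Y = (fun x => x) ∘ Y from rfl, ← h1, Real.coe_toNNReal _
    (integral_nonneg fun q => sq_nonneg _)]

/-- The isometry property of the Wiener integral. -/
lemma IsWienerIntegral.integral_mul (hW : IsWhiteNoise W P) {h k : ℝ × ℝ → ℝ} {X Y : Ω → ℝ}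
    (hX : IsWienerIntegral W P h X) (hY : IsWienerIntegral W P k Y) :
    ∫ ω, X ω * Y ω ∂P = ∫ q, h q * k q := by
  have h1 := (hX.add_smul hW hY 1 1).integral_sq hW
  simp only [one_mul] at h1
  rw [integral_add_sq hX.2.1 hY.2.1, integral_add_sq hX.1 hY.1, hX.integral_sq hW, hY.integral_sq hW] at h1
  linarith

/-- Every linear functional of the pair is itself a Wiener integral, hence Gaussian in one
dimension, and this characterizes Gaussian laws on the plane. -/
lemma IsWienerIntegral.hasGaussianLaw_prodMk (hW : IsWhiteNoise W P) {h k : ℝ × ℝ → ℝ}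
    {X Y : Ω → ℝ} (hX : IsWienerIntegral W P h X) (hY : IsWienerIntegral W P k Y) :
    HasGaussianLaw (fun ω => (X ω, Y ω)) P := by
  have hm : AEMeasurable (fun ω => (X ω, Y ω)) P :=
    hX.2.1.1.aemeasurable.prodMk hY.2.1.1.aemeasurable
  refine ⟨isGaussian_of_map_eq_gaussianReal fun L => ?_⟩
  have h1 := (hX.add_smul hW hY (L (1, 0)) (L (0, 1))).map_eq hW
  refine ⟨0, (∫ q, (L (1, 0) * h q + L (0, 1) * k q) ^ 2).toNNReal, ?_⟩
  rw [AEMeasurable.map_map_of_aemeasurable (by fun_prop) hm, ← h1]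
  congr 1
  ext ω
  have : (X ω, Y ω) = X ω • ((1 : ℝ), (0 : ℝ)) + Y ω • ((0 : ℝ), (1 : ℝ)) := by simp
  simp only [Function.comp]
  rw [this, map_add, map_smul, map_smul, smul_eq_mul, smul_eq_mul]
  ring

/-- By the isometry, orthogonal integrands give uncorrelated variables, and jointly Gaussian
uncorrelated variables are independent. -/
lemma IsWienerIntegral.indepFun (hW : IsWhiteNoise W P) {h k : ℝ × ℝ → ℝ}
    {X Y : Ω → ℝ} (hX : IsWienerIntegral W P h X) (hY : IsWienerIntegral W P k Y)
    (h0 : ∫ q, h q * k q = 0) : IndepFun X Y P := by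
  have := hW.isGaussianProcess.isProbabilityMeasure
  refine (hX.hasGaussianLaw_prodMk hW hY).indepFun_of_covariance_eq_zero ?_
  rw [covariance_eq_sub hX.2.1 hY.2.1, hX.integral_eq_zero hW, zero_mul, sub_zero]
  exact (hX.integral_mul hW hY).trans h0

end WienerIntegral

/-! ### The heat kernel and the spatial covariance of the mild solution. -/

lemma green_of_pos {t : ℝ} (ht : 0 < t) (x : ℝ) :
    green t x = (√(2 * Real.pi * t))⁻¹ * Real.exp (-(x ^ 2) / (2 * t)) := if_pos ht

lemma green_neg (t x : ℝ) : green t (-x) = green t x := by simp [green]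

lemma green_nonneg (t x : ℝ) : 0 ≤ green t x := by
  unfold green; split_ifs <;> positivity

lemma measurable_green (x : ℝ) : Measurable fun t => green t x :=
  Measurable.ite measurableSet_Ioi (by fun_prop) measurable_const

/-- The semigroup property of the heat kernel, for equal times. -/
lemma integral_green_mul_green {τ : ℝ} (hτ : 0 < τ) (x y : ℝ) :
    ∫ w, green τ (x - w) * green τ (y - w) = green (2 * τ) (x - y) := by
  have hπ := Real.pi_pos
  have h1 : ∀ w, green τ (x - w) * green τ (y - w) =
      ((2 * Real.pi * τ)⁻¹ * Real.exp (-((x - y) ^ 2) / (4 * τ))) *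
        Real.exp (-(1 / τ) * (w - (x + y) / 2) ^ 2) := by
    intro w
    rw [green_of_pos hτ, green_of_pos hτ, mul_mul_mul_comm, ← Real.exp_add, ← mul_inv,
      Real.mul_self_sqrt (by positivity), mul_assoc (2 * Real.pi * τ)⁻¹, ← Real.exp_add]
    congr 2
    field_simp
    ring
  simp only [h1]
  rw [integral_const_mul, integral_sub_right_eq_self fun w => Real.exp (-(1 / τ) * w ^ 2),
    integral_gaussian, green_of_pos (by positivity)]
  have h2 : √(2 * Real.pi * (2 * τ)) = 2 * √(Real.pi * τ) := by
    rw [show 2 * Real.pi * (2 * τ) = 2 ^ 2 * (Real.pi * τ) by ring, Real.sqrt_mul (by positivity),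
      Real.sqrt_sq (by norm_num)]
  have h3 : Real.pi / (1 / τ) = Real.pi * τ := by field_simp
  have h4 : √(Real.pi * τ) * √(Real.pi * τ) = Real.pi * τ := Real.mul_self_sqrt (by positivity)
  have h5 : 0 < √(Real.pi * τ) := by positivity
  rw [h2, h3, show 2 * (2 * τ) = 4 * τ by ring, mul_right_comm]
  congr 1
  rw [show 2 * Real.pi * τ = 2 * (√(Real.pi * τ) * √(Real.pi * τ)) by rw [h4]; ring]
  field_simp

/-- The covariance function `E[u(t, x) u(t, x + z)]` of the mild solution at time `t`. -/
noncomputable def greenPotential (t z : ℝ) : ℝ := ∫ v in 0..t, green (2 * v) z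

lemma greenPotential_neg (t z : ℝ) : greenPotential t (-z) = greenPotential t z := by
  simp [greenPotential, green_neg]

lemma integral_mildKernel_mul {t x y : ℝ} (ht : 0 ≤ t) (hx : MemLp (mildKernel t x) 2 volume)
    (hy : MemLp (mildKernel t y) 2 volume) :
    ∫ q, mildKernel t x q * mildKernel t y q = greenPotential t (x - y) := by
  have h1 : Integrable (fun q => mildKernel t x q * mildKernel t y q) (volume.prod volume) :=
    hx.integrable_mul hy
  rw [Measure.volume_eq_prod, integral_prod _ h1]
  have h2 : ∀ s, ∫ w, mildKernel t x (s, w) * mildKernel t y (s, w) =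
      (Ioc 0 t).indicator (fun s => green (2 * (t - s)) (x - y)) s := by
    intro s
    by_cases hs : s ∈ Ioc 0 t
    · simp only [mildKernel, mem_prod, hs, mem_univ, and_self, indicator_of_mem]
      rcases hs.2.lt_or_eq with h | h
      · exact integral_green_mul_green (sub_pos.2 h) x y
      -- At s = t both sides vanish, since `green` is 0 at time 0.
      · simp [h, green]
    · simp [mildKernel, hs]
  simp only [h2]
  rw [integral_indicator measurableSet_Ioc, ← intervalIntegral.integral_of_le ht,
    intervalIntegral.integral_comp_sub_left (fun s => green (2 * s) (x - y)) t]
  simp [greenPotential]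

/-! ### A closed form of the covariance and its corner at the origin. -/

/-- The integral of the Gauss function from `0`. -/
noncomputable def gaussPrimitive (x : ℝ) : ℝ := ∫ w in 0..x, Real.exp (-w ^ 2)

lemma hasDerivAt_gaussPrimitive (x : ℝ) : HasDerivAt gaussPrimitive (Real.exp (-x ^ 2)) x :=
  ((by fun_prop : Continuous fun w : ℝ => Real.exp (-w ^ 2)).integral_hasStrictDerivAt 0 x).hasDerivAt

lemma tendsto_gaussPrimitive : Tendsto gaussPrimitive atTop (𝓝 (√Real.pi / 2)) := by
  have h := integral_gaussian_Ioi 1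
  simp only [neg_mul, one_mul, div_one] at h
  rw [← h]
  refine intervalIntegral_tendsto_integral_Ioi 0 ?_ tendsto_id
  simpa using (integrable_exp_neg_mul_sq (b := 1) one_pos).integrableOn

/-- A closed form of `greenPotential t` on the positive half-line. -/
noncomputable def potential (t z : ℝ) : ℝ :=
  √(t / Real.pi) * Real.exp (-(z ^ 2) / (4 * t)) -
    z / √Real.pi * (√Real.pi / 2 - gaussPrimitive (z / (2 * √t)))

/-- The z-derivative of `potential t`. Its value -1/2 at z = 0 is the slope at the corner of the
even covariance, and the source of the Brownian size of the increments. -/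
noncomputable def potentialDeriv (t z : ℝ) : ℝ :=
  -(1 / √Real.pi) * (√Real.pi / 2 - gaussPrimitive (z / (2 * √t)))

lemma sq_div_two_sqrt {t : ℝ} (ht : 0 < t) (z : ℝ) :
    -(z / (2 * √t)) ^ 2 = -(z ^ 2) / (4 * t) := by
  rw [div_pow, mul_pow, Real.sq_sqrt ht.le]; ring

lemma hasDerivAt_potential_time {t : ℝ} (ht : 0 < t) (z : ℝ) :
    HasDerivAt (fun t => potential t z) (green (2 * t) z) t := by
  have hπ := Real.pi_pos
  have hs := Real.sqrt_pos.2 ht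
  have hp := Real.sqrt_pos.2 hπ
  have h1 : HasDerivAt (fun t => √(t / Real.pi)) (1 / Real.pi / (2 * √(t / Real.pi))) t :=
    ((hasDerivAt_id t).div_const _).sqrt (div_pos ht hπ).ne'
  have h2 : HasDerivAt (fun t => Real.exp (-(z ^ 2) / (4 * t)))
      (Real.exp (-(z ^ 2) / (4 * t)) * ((0 * (4 * t) - -(z ^ 2) * (4 * 1)) / (4 * t) ^ 2)) t :=
    ((hasDerivAt_const t (-(z ^ 2))).div ((hasDerivAt_id t).const_mul 4) (by positivity)).exp
  have h3 : HasDerivAt (fun t => z / (2 * √t))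
      ((0 * (2 * √t) - z * (2 * (1 / (2 * √t)))) / (2 * √t) ^ 2) t :=
    (hasDerivAt_const t z).div ((Real.hasDerivAt_sqrt ht.ne').const_mul 2) (by positivity)
  have h4 := (hasDerivAt_gaussPrimitive (z / (2 * √t))).comp t h3
  have h5 := (h1.mul h2).sub ((h4.const_sub (√Real.pi / 2)).const_mul (z / √Real.pi))
  refine h5.congr_deriv ?_
  rw [green_of_pos (by positivity), sq_div_two_sqrt ht,
    show -(z ^ 2) / (2 * (2 * t)) = -(z ^ 2) / (4 * t) by ring,
    show 2 * Real.pi * (2 * t) = 2 ^ 2 * (Real.pi * t) by ring, Real.sqrt_mul (by positivity),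
    Real.sqrt_mul hπ.le, Real.sqrt_sq (by norm_num), Real.sqrt_div ht.le]
  generalize Real.exp (-(z ^ 2) / (4 * t)) = e
  have e1 : t = √t ^ 2 := (Real.sq_sqrt ht.le).symm
  have e2 : Real.pi = √Real.pi ^ 2 := (Real.sq_sqrt hπ.le).symm
  -- In terms of √t and √π the claim becomes a rational identity.
  generalize √t = a at *
  generalize √Real.pi = b at *
  subst e1
  rw [e2]
  field_simp
  ring

/-- For z > 0 the argument of `gaussPrimitive` tends to +∞, where its limit √π/2 cancels the
constant in `potential`; for z = 0 the second term is zero. For z < 0 the limit would be -z. -/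
lemma tendsto_potential_zero {z : ℝ} (hz : 0 ≤ z) :
    Tendsto (fun t => potential t z) (𝓝[>] 0) (𝓝 0) := by
  have h1 : Tendsto (fun t => √(t / Real.pi) * Real.exp (-(z ^ 2) / (4 * t))) (𝓝[>] 0) (𝓝 0) := by
    have h2 : Tendsto (fun t => √(t / Real.pi)) (𝓝[>] 0) (𝓝 0) := by
      have : Continuous fun t => √(t / Real.pi) := by fun_prop
      simpa using (this.tendsto 0).mono_left nhdsWithin_le_nhds
    refine tendsto_of_tendsto_of_tendsto_of_le_of_le' tendsto_const_nhds h2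
      (Eventually.of_forall fun t => by positivity) ?_
    filter_upwards [self_mem_nhdsWithin] with t ht
    have ht : 0 < t := ht
    refine mul_le_of_le_one_right (by positivity) (Real.exp_le_one_iff.2 ?_)
    rw [neg_div]
    exact neg_nonpos.2 (by positivity)
  have h3 : Tendsto (fun t => z / √Real.pi * (√Real.pi / 2 - gaussPrimitive (z / (2 * √t))))
      (𝓝[>] 0) (𝓝 0) := by
    rcases hz.eq_or_lt with rfl | hz
    · simp
    · have h4 : Tendsto (fun t => z / (2 * √t)) (𝓝[>] 0) atTop := by
        refine Tendsto.const_mul_atTop hz (tendsto_inv_nhdsGT_zero.comp ?_)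
        refine tendsto_nhdsWithin_of_tendsto_nhds_of_eventually_within _ ?_ ?_
        · have : Continuous fun t => 2 * √t := by fun_prop
          simpa using (this.tendsto 0).mono_left nhdsWithin_le_nhds
        · filter_upwards [self_mem_nhdsWithin] with t ht
          have := Real.sqrt_pos.2 (show 0 < t from ht)
          simpa using this
      have h5 := ((tendsto_gaussPrimitive.comp h4).const_sub (√Real.pi / 2)).const_mul
        (z / √Real.pi)
      simpa using h5
  simpa [potential] using h1.sub h3

lemma intervalIntegrable_green (t z : ℝ) (ht : 0 < t) :
    IntervalIntegrable (fun v => green (2 * v) z) volume 0 t := by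
  have h1 : IntervalIntegrable (fun v : ℝ => (√(4 * Real.pi))⁻¹ * v ^ (-(1 / 2) : ℝ)) volume 0 t :=
    (intervalIntegral.intervalIntegrable_rpow' (by norm_num)).const_mul _
  refine h1.mono_fun ((measurable_green z).comp (measurable_const_mul 2)).aestronglyMeasurable ?_
  refine (ae_restrict_iff' measurableSet_uIoc).2 (ae_of_all _ fun v hv => ?_)
  rw [uIoc_of_le ht.le] at hv
  have hv0 : 0 < v := hv.1
  simp only
  rw [Real.norm_of_nonneg (green_nonneg _ _), Real.norm_of_nonneg (by positivity),
    green_of_pos (by positivity), show 2 * Real.pi * (2 * v) = (4 * Real.pi) * v by ring,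
    Real.sqrt_mul (by positivity), mul_inv, Real.rpow_neg hv0.le, ← Real.sqrt_eq_rpow]
  refine mul_le_of_le_one_right (by positivity) (Real.exp_le_one_iff.2 ?_)
  rw [neg_div]
  exact neg_nonpos.2 (by positivity)

/-- Both sides have the same time derivative and tend to 0 as t → 0+; the singularity at time 0 is
integrable, of order v^(-1/2). -/
lemma greenPotential_eq {t z : ℝ} (ht : 0 < t) (hz : 0 ≤ z) :
    greenPotential t z = potential t z := by
  rw [greenPotential, intervalIntegral.integral_eq_sub_of_hasDerivAt_of_tendsto ht
    (fun v hv => hasDerivAt_potential_time hv.1 z) (intervalIntegrable_green t z ht)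
    (tendsto_potential_zero hz)
    ((hasDerivAt_potential_time ht z).continuousAt.tendsto.mono_left nhdsWithin_le_nhds), sub_zero]

lemma hasDerivAt_gaussPrimitive_scaled {t : ℝ} (ht : 0 < t) (z : ℝ) :
    HasDerivAt (fun z => gaussPrimitive (z / (2 * √t)))
      (Real.exp (-(z ^ 2) / (4 * t)) * (1 / (2 * √t))) z := by
  rw [← sq_div_two_sqrt ht]
  exact (hasDerivAt_gaussPrimitive (z / (2 * √t))).comp z ((hasDerivAt_id z).div_const _)

lemma hasDerivAt_potential {t : ℝ} (ht : 0 < t) (z : ℝ) :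
    HasDerivAt (potential t) (potentialDeriv t z) z := by
  have hπ := Real.pi_pos
  have hs := Real.sqrt_pos.2 ht
  have hp := Real.sqrt_pos.2 hπ
  have h2 : HasDerivAt (fun z => Real.exp (-(z ^ 2) / (4 * t)))
      (Real.exp (-(z ^ 2) / (4 * t)) * (-(2 * z) / (4 * t))) z := by
    have h := ((hasDerivAt_pow 2 z).neg.div_const (4 * t)).exp
    simpa using h
  have h5 := (h2.const_mul √(t / Real.pi)).sub (((hasDerivAt_id z).div_const √Real.pi).mul
    ((hasDerivAt_gaussPrimitive_scaled ht z).const_sub (√Real.pi / 2)))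
  refine h5.congr_deriv ?_
  rw [potentialDeriv, Real.sqrt_div ht.le]
  simp only [id]
  generalize Real.exp (-(z ^ 2) / (4 * t)) = e
  have e1 : t = √t ^ 2 := (Real.sq_sqrt ht.le).symm
  generalize √t = a at *
  subst e1
  field_simp
  ring

lemma hasDerivAt_potentialDeriv {t : ℝ} (ht : 0 < t) (z : ℝ) :
    HasDerivAt (potentialDeriv t)
      (1 / √Real.pi * (Real.exp (-(z ^ 2) / (4 * t)) * (1 / (2 * √t)))) z := by
  have h := ((hasDerivAt_gaussPrimitive_scaled ht z).const_sub (√Real.pi / 2)).const_mul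
    (-(1 / √Real.pi))
  exact h.congr_deriv (by ring)

lemma potentialDeriv_zero (t : ℝ) : potentialDeriv t 0 = -(1 / 2) := by
  have := Real.sqrt_pos.2 Real.pi_pos
  simp only [potentialDeriv, gaussPrimitive, zero_div, intervalIntegral.integral_same, sub_zero]
  field_simp

lemma abs_potentialDeriv_sub_le {t : ℝ} (ht : 0 < t) (x y : ℝ) :
    |potentialDeriv t x - potentialDeriv t y| ≤ 1 / √Real.pi * (1 / (2 * √t)) * |x - y| := by
  refine convex_univ.norm_image_sub_le_of_norm_hasDerivWithin_le
    (fun z _ => (hasDerivAt_potentialDeriv ht z).hasDerivWithinAt) (fun z _ => ?_)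
    (mem_univ y) (mem_univ x)
  rw [Real.norm_of_nonneg (by positivity)]
  refine mul_le_mul_of_nonneg_left (mul_le_of_le_one_left (by positivity)
    (Real.exp_le_one_iff.2 ?_)) (by positivity)
  rw [neg_div]
  exact neg_nonpos.2 (by positivity)

/-- The covariance function of the increments over steps of size `s`. -/
noncomputable def incrementCov (t s z : ℝ) : ℝ :=
  2 * greenPotential t z - greenPotential t (z + s) - greenPotential t (z - s)

lemma incrementCov_neg (t s z : ℝ) : incrementCov t s (-z) = incrementCov t s z := by
  rw [incrementCov, incrementCov, greenPotential_neg, show -z + s = -(z - s) by ring,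
    greenPotential_neg, show -z - s = -(z + s) by ring, greenPotential_neg]
  ring

/-- Over short steps, the increments have nearly the variance of those of a Brownian motion, and
distant increments are nearly uncorrelated. -/
theorem exists_incrementCov_bound {t : ℝ} (ht : 0 < t) : ∃ M : ℝ, 0 < M ∧ ∀ s > 0,
    |incrementCov t s 0 - s| ≤ M * s ^ 2 ∧ ∀ z, s ≤ |z| → |incrementCov t s z| ≤ M * s ^ 2 := by
  have hs := Real.sqrt_pos.2 ht
  have hp := Real.sqrt_pos.2 Real.pi_pos
  -- `K` is the Lipschitz constant of `potentialDeriv t`.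
  set K := 1 / √Real.pi * (1 / (2 * √t)) with hK
  have hK0 : 0 < K := by positivity
  have mvt : ∀ a b, a < b → ∃ c ∈ Ioo a b,
      potential t b - potential t a = potentialDeriv t c * (b - a) := by
    intro a b hab
    obtain ⟨c, hc, h⟩ := exists_hasDerivAt_eq_slope (potential t) (potentialDeriv t) hab
      (fun z _ => (hasDerivAt_potential ht z).continuousAt.continuousWithinAt)
      fun z _ => hasDerivAt_potential ht z
    refine ⟨c, hc, ?_⟩
    rw [h, div_mul_cancel₀ _ (sub_pos.2 hab).ne']
  refine ⟨2 * K, by positivity, fun s hs0 => ⟨?_, ?_⟩⟩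
  -- By evenness the variance is minus twice the change of `potential t` over [0, s], which is -2 ·
  -- (-1/2) · s up to the variation of the slope.
  · have h1 : incrementCov t s 0 = 2 * potential t 0 - 2 * potential t s := by
      rw [incrementCov, zero_add, zero_sub, greenPotential_neg, greenPotential_eq ht le_rfl,
        greenPotential_eq ht hs0.le]
      ring
    obtain ⟨c, hc, h⟩ := mvt 0 s hs0
    have h2 := abs_potentialDeriv_sub_le ht c 0
    rw [potentialDeriv_zero, sub_zero, abs_of_pos hc.1] at h2
    have h3 : incrementCov t s 0 - s = -(2 * s) * (potentialDeriv t c - -(1 / 2)) := by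
      rw [h1]; linear_combination -2 * h
    rw [h3, abs_mul, abs_neg, abs_of_pos (by positivity)]
    calc 2 * s * |potentialDeriv t c - -(1 / 2)| ≤ 2 * s * (K * s) := by
          gcongr
          exact h2.trans (mul_le_mul_of_nonneg_left hc.2.le hK0.le)
      _ = 2 * K * s ^ 2 := by ring
  -- The points z - s, z, z + s are all nonnegative, so the corner is not crossed and the second
  -- difference is s times a difference of slopes at points less than 2s apart.
  · have main : ∀ z, s ≤ z → |incrementCov t s z| ≤ 2 * K * s ^ 2 := by
      intro z hz
      obtain ⟨c, hc, h⟩ := mvt z (z + s) (by linarith)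
      obtain ⟨d, hd, h'⟩ := mvt (z - s) z (by linarith)
      have h2 := abs_potentialDeriv_sub_le ht d c
      have h1 : incrementCov t s z = s * (potentialDeriv t d - potentialDeriv t c) := by
        rw [incrementCov, greenPotential_eq ht (by linarith), greenPotential_eq ht (by linarith),
          greenPotential_eq ht (by linarith)]
        linear_combination h' - h
      rw [h1, abs_mul, abs_of_pos hs0]
      calc s * |potentialDeriv t d - potentialDeriv t c| ≤ s * (K * (2 * s)) := by
            gcongr
            refine h2.trans (mul_le_mul_of_nonneg_left ?_ hK0.le)
            rw [abs_le]
            exact ⟨by linarith [hc.2, hd.1], by linarith [hc.1, hd.2]⟩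
        _ = 2 * K * s ^ 2 := by ring
    intro z hz
    rcases abs_choice z with h | h
    · exact main z (h ▸ hz)
    · rw [← incrementCov_neg]
      exact main (-z) (h ▸ hz)

/-! ### Powers of correlated Gaussian variables. -/

/-- The absolute moment of order `p` of the standard normal law. -/
noncomputable def gaussMoment (p : ℝ) : ℝ := ∫ x, |x| ^ p ∂(gaussianReal 0 1)

lemma integrable_abs_rpow_gaussianReal {p : ℝ} (hp : 0 < p) :
    Integrable (fun x => |x| ^ p) (gaussianReal 0 1) := by
  have h := (memLp_id_gaussianReal' (μ := 0) (v := 1) (ENNReal.ofReal p)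
    ENNReal.ofReal_ne_top).integrable_norm_rpow (by simpa using hp) ENNReal.ofReal_ne_top
  simpa [ENNReal.toReal_ofReal hp.le] using h

lemma gaussMoment_pos {p : ℝ} (hp : 0 < p) : 0 < gaussMoment p := by
  rw [gaussMoment, integral_pos_iff_support_of_nonneg (fun x => by positivity)
    (integrable_abs_rpow_gaussianReal hp)]
  have h1 : Ioo (0 : ℝ) 1 ⊆ Function.support fun x : ℝ => |x| ^ p := fun x hx => by
    simp [hp.ne', hx.1.ne']
  refine lt_of_lt_of_le (pos_iff_ne_zero.2 fun h => ?_) (measure_mono h1)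
  simpa using gaussianReal_absolutelyContinuous' 0 one_ne_zero h

section

variable {Ω : Type*} [MeasurableSpace Ω] {P : Measure Ω}

lemma integrable_abs_rpow_of_map_eq {X : Ω → ℝ} (hX : AEMeasurable X P)
    (h : P.map X = gaussianReal 0 1) {p : ℝ} (hp : 0 < p) :
    Integrable (fun ω => |X ω| ^ p) P := by
  have h1 := integrable_abs_rpow_gaussianReal hp
  rw [← h] at h1
  exact h1.comp_aemeasurable hX

lemma integral_abs_rpow_of_map_eq {X : Ω → ℝ} (hX : AEMeasurable X P)
    (h : P.map X = gaussianReal 0 1) (p : ℝ) : ∫ ω, |X ω| ^ p ∂P = gaussMoment p := by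
  rw [gaussMoment, ← h, integral_map hX
    (by fun_prop : Measurable fun x : ℝ => |x| ^ p).aestronglyMeasurable]

lemma abs_rpow_sub_rpow_le {p a b c : ℝ} (hp : 1 ≤ p) (ha : 0 ≤ a) (hb : 0 ≤ b) (hac : a ≤ c)
    (hbc : b ≤ c) : |a ^ p - b ^ p| ≤ p * c ^ (p - 1) * |a - b| := by
  refine (convex_Icc 0 c).norm_image_sub_le_of_norm_hasDerivWithin_le
    (fun z _ => (Real.hasDerivAt_rpow_const (Or.inr hp)).hasDerivWithinAt) (fun z hz => ?_)
    ⟨hb, hbc⟩ ⟨ha, hac⟩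
  have := hz.1
  rw [Real.norm_of_nonneg (by positivity)]
  exact mul_le_mul_of_nonneg_left (Real.rpow_le_rpow hz.1 hz.2 (by linarith)) (by linarith)

/-- The base is at most three times the largest of 1, a, b. This bounds a common majorant of the
variables by terms with known Gaussian moments. -/
lemma one_add_add_rpow_le {a b q : ℝ} (ha : 0 ≤ a) (hb : 0 ≤ b) (hq : 0 ≤ q) :
    (1 + a + b) ^ q ≤ 3 ^ q * (1 + a ^ q + b ^ q) := by
  have key : ∀ c : ℝ, 0 ≤ c → 1 + a + b ≤ 3 * c → c ^ q ≤ 1 + a ^ q + b ^ q →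
      (1 + a + b) ^ q ≤ 3 ^ q * (1 + a ^ q + b ^ q) := fun c hc h1 h2 => by
    calc (1 + a + b) ^ q ≤ (3 * c) ^ q := by gcongr
      _ = 3 ^ q * c ^ q := Real.mul_rpow (by norm_num) hc
      _ ≤ _ := by gcongr
  have ha' : 0 ≤ a ^ q := by positivity
  have hb' : 0 ≤ b ^ q := by positivity
  rcases le_total a b with h | h
  · rcases le_total b 1 with h1 | h1
    · exact key 1 zero_le_one (by linarith) (by rw [Real.one_rpow]; linarith)
    · exact key b hb (by linarith) (by linarith)
  · rcases le_total a 1 with h1 | h1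
    · exact key 1 zero_le_one (by linarith) (by rw [Real.one_rpow]; linarith)
    · exact key a ha (by linarith) (by linarith)

/-- A constant for the covariance bound `abs_integral_centered_mul_le`. -/
noncomputable def covConst (p : ℝ) : ℝ :=
  (1 + gaussMoment p) * p * (3 ^ (2 * p) * (1 + gaussMoment (2 * p) + gaussMoment (2 * p)))

lemma covConst_nonneg {p : ℝ} (hp : 1 ≤ p) : 0 ≤ covConst p := by
  have h1 := gaussMoment_pos (p := p) (by linarith)
  have h2 := gaussMoment_pos (p := 2 * p) (by linarith)
  unfold covConst
  positivity

/-- The covariance of the `p`-th powers of two standard normal variables is bounded by their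
correlation. -/
theorem abs_integral_centered_mul_le [IsProbabilityMeasure P] {p ρ : ℝ} (hp : 1 ≤ p)
    (hρ : |ρ| ≤ 1) {X Y : Ω → ℝ} (hXm : AEMeasurable X P) (hYm : AEMeasurable Y P)
    (hX : P.map X = gaussianReal 0 1) (hY : P.map Y = gaussianReal 0 1)
    (hind : IndepFun X (fun ω => Y ω - ρ * X ω) P) :
    |∫ ω, (|X ω| ^ p - gaussMoment p) * (|Y ω| ^ p - gaussMoment p) ∂P| ≤ covConst p * |ρ| := by
  have hp0 : 0 < p := by linarith
  set m := gaussMoment p with hm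
  have hm0 : 0 < m := gaussMoment_pos hp0
  have hXi := integrable_abs_rpow_of_map_eq hXm hX hp0
  have hX2 := integrable_abs_rpow_of_map_eq hXm hX (p := 2 * p) (by linarith)
  have hY2 := integrable_abs_rpow_of_map_eq hYm hY (p := 2 * p) (by linarith)
  -- `Z` is the part of `Y` independent of `X`. Replacing |Y|^p by |Z|^p makes the covariance with
  -- |X|^p zero, and costs O(|ρ|) since Y - Z = ρ X.
  let Z : Ω → ℝ := fun ω => Y ω - ρ * X ω
  have hZm : AEMeasurable Z P := hYm.sub (hXm.const_mul ρ)
  -- `H` dominates 1, |X|, |Y| and |Z| at once; the summand 1 lets it absorb the constant m as well.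
  let H : Ω → ℝ := fun ω => 1 + |X ω| + |Y ω|
  have hH1 : ∀ ω, 1 ≤ H ω := fun ω => by
    have := abs_nonneg (X ω); have := abs_nonneg (Y ω); simp only [H]; linarith
  have hH0 : ∀ ω, 0 ≤ H ω := fun ω => zero_le_one.trans (hH1 ω)
  have hXH : ∀ ω, |X ω| ≤ H ω := fun ω => by
    have := abs_nonneg (Y ω); simp only [H]; linarith
  have hYH : ∀ ω, |Y ω| ≤ H ω := fun ω => by
    have := abs_nonneg (X ω); simp only [H]; linarith
  have hρX : ∀ ω, |ρ * X ω| ≤ |X ω| := fun ω => by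
    rw [abs_mul]; exact mul_le_of_le_one_left (abs_nonneg _) hρ
  have hZH : ∀ ω, |Z ω| ≤ H ω := fun ω => by
    have := abs_sub (Y ω) (ρ * X ω); have := hρX ω; simp only [H, Z]; linarith
  have hHp : ∀ ω, 1 ≤ H ω ^ p := fun ω => Real.one_le_rpow (hH1 ω) hp0.le
  have hHH : ∀ ω, H ω ^ p * H ω ^ p = H ω ^ (2 * p) := fun ω => by
    rw [← Real.rpow_add (lt_of_lt_of_le one_pos (hH1 ω))]; congr 1; ring
  let G : Ω → ℝ := fun ω => 3 ^ (2 * p) * (1 + |X ω| ^ (2 * p) + |Y ω| ^ (2 * p))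
  have hHG : ∀ ω, H ω ^ (2 * p) ≤ G ω := fun ω =>
    one_add_add_rpow_le (abs_nonneg _) (abs_nonneg _) (by linarith)
  have hGi : Integrable G P := (((integrable_const 1).add hX2).add hY2).const_mul _
  have hGint : ∫ ω, G ω ∂P = 3 ^ (2 * p) * (1 + gaussMoment (2 * p) + gaussMoment (2 * p)) := by
    simp only [G]
    rw [integral_const_mul, integral_add (f := fun ω => 1 + |X ω| ^ (2 * p))
      ((integrable_const 1).add hX2) hY2, integral_add (integrable_const 1) hX2,
      integral_abs_rpow_of_map_eq hXm hX, integral_abs_rpow_of_map_eq hYm hY]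
    simp
  have hA : ∀ ω, |(|X ω| ^ p - m)| ≤ (1 + m) * H ω ^ p := fun ω => by
    have h1 : |X ω| ^ p ≤ H ω ^ p := Real.rpow_le_rpow (abs_nonneg _) (hXH ω) hp0.le
    have h2 : 0 ≤ |X ω| ^ p := by positivity
    have h3 := hHp ω
    rw [abs_le]
    constructor <;> nlinarith
  have dom : ∀ V : Ω → ℝ, AEMeasurable V P → (∀ ω, |V ω| ≤ H ω) →
      Integrable (fun ω => (|X ω| ^ p - m) * |V ω| ^ p) P := by
    intro V hV hVH
    refine (hGi.const_mul (1 + m)).mono' ?_ (ae_of_all _ fun ω => ?_)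
    · have : AEMeasurable (fun ω => (|X ω| ^ p - m) * |V ω| ^ p) P := by fun_prop
      exact this.aestronglyMeasurable
    · have h1 : |V ω| ^ p ≤ H ω ^ p := Real.rpow_le_rpow (abs_nonneg _) (hVH ω) hp0.le
      rw [Real.norm_eq_abs, abs_mul, abs_of_nonneg (by positivity : 0 ≤ |V ω| ^ p)]
      calc _ ≤ ((1 + m) * H ω ^ p) * H ω ^ p := mul_le_mul (hA ω) h1 (by positivity)
            ((abs_nonneg _).trans (hA ω))
        _ = (1 + m) * H ω ^ (2 * p) := by rw [mul_assoc, hHH]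
        _ ≤ _ := mul_le_mul_of_nonneg_left (hHG ω) (by linarith)
  have hXc : ∫ ω, (|X ω| ^ p - m) ∂P = 0 := by
    rw [integral_sub hXi (integrable_const _), integral_abs_rpow_of_map_eq hXm hX]
    simp [hm]
  have hXZ : ∫ ω, (|X ω| ^ p - m) * |Z ω| ^ p ∂P = 0 := by
    have h1 : IndepFun (fun ω => |X ω| ^ p - m) (fun ω => |Z ω| ^ p) P :=
      hind.comp (φ := fun x => |x| ^ p - m) (ψ := fun x => |x| ^ p) (by fun_prop) (by fun_prop)
    rw [h1.integral_fun_mul_eq_mul_integral (hXi.sub (integrable_const _)).1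
      (by fun_prop : AEMeasurable (fun ω => |Z ω| ^ p) P).aestronglyMeasurable, hXc, zero_mul]
  have e : ∫ ω, (|X ω| ^ p - m) * (|Y ω| ^ p - m) ∂P =
      ∫ ω, ((|X ω| ^ p - m) * |Y ω| ^ p - (|X ω| ^ p - m) * |Z ω| ^ p) ∂P := by
    rw [integral_sub (dom Y hYm hYH) (dom Z hZm hZH), hXZ, sub_zero]
    have h1 : ∀ ω, (|X ω| ^ p - m) * (|Y ω| ^ p - m) =
        (|X ω| ^ p - m) * |Y ω| ^ p - m * (|X ω| ^ p - m) := fun ω => by ring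
    simp only [h1]
    have h2 : Integrable (fun ω => m * (|X ω| ^ p - m)) P :=
      (hXi.sub (integrable_const _)).const_mul m
    rw [integral_sub (dom Y hYm hYH) h2,
      integral_const_mul, hXc, mul_zero, sub_zero]
  rw [e]
  have hb : ∀ ω, ‖(|X ω| ^ p - m) * |Y ω| ^ p - (|X ω| ^ p - m) * |Z ω| ^ p‖ ≤
      (1 + m) * p * |ρ| * G ω := fun ω => by
    rw [← mul_sub, norm_mul, Real.norm_eq_abs, Real.norm_eq_abs]
    have h1 := abs_rpow_sub_rpow_le hp (abs_nonneg _) (abs_nonneg _) (hYH ω) (hZH ω)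
    have h2 : |(|Y ω| - |Z ω|)| ≤ |ρ| * H ω := by
      refine (abs_abs_sub_abs_le _ _).trans ?_
      rw [show Y ω - Z ω = ρ * X ω by simp [Z], abs_mul]
      exact mul_le_mul_of_nonneg_left (hXH ω) (abs_nonneg _)
    have h3 : H ω ^ (p - 1) * H ω = H ω ^ p := by
      have := lt_of_lt_of_le one_pos (hH1 ω)
      rw [← Real.rpow_add_one this.ne']; congr 1; ring
    have h4 : |(|Y ω| ^ p - |Z ω| ^ p)| ≤ p * |ρ| * H ω ^ p := by
      refine h1.trans ((mul_le_mul_of_nonneg_left h2 ?_).trans_eq ?_)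
      · have := hH0 ω; positivity
      · rw [← h3]; ring
    calc _ ≤ ((1 + m) * H ω ^ p) * (p * |ρ| * H ω ^ p) := mul_le_mul (hA ω) h4 (abs_nonneg _)
          ((abs_nonneg _).trans (hA ω))
      _ = (1 + m) * p * |ρ| * H ω ^ (2 * p) := by rw [← hHH]; ring
      _ ≤ _ := mul_le_mul_of_nonneg_left (hHG ω) (by positivity)
  refine (norm_integral_le_of_norm_le (hGi.const_mul _) (ae_of_all _ hb)).trans_eq ?_
  rw [integral_const_mul, hGint, covConst]
  ring

end

/-! ### Second moments of integrated random fields, and almost sure convergence. -/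

section SecondMoment

variable {α Ω : Type*} [MeasurableSpace α] [MeasurableSpace Ω] {μ : Measure α} {P : Measure Ω}

/-- The second moment of an integral is the integral of the second mixed moments. -/
lemma integral_sq_integral_le [IsFiniteMeasure μ] [IsProbabilityMeasure P] {Φ : α × Ω → ℝ}
    (hΦ : Measurable Φ) (hΦ2 : Integrable (fun q => Φ q ^ 2) (μ.prod P)) {B : α × α → ℝ}
    (hB : Integrable B (μ.prod μ))
    (hΦB : ∀ᵐ q ∂μ.prod μ, |∫ ω, Φ (q.1, ω) * Φ (q.2, ω) ∂P| ≤ B q) :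
    Integrable (fun ω => (∫ a, Φ (a, ω) ∂μ) ^ 2) P ∧
      ∫ ω, (∫ a, Φ (a, ω) ∂μ) ^ 2 ∂P ≤ ∫ q, B q ∂μ.prod μ := by
  -- The square is a double integral, which Fubini exchanges with the expectation; integrability of
  -- the product follows from that of Φ² through |ab| ≤ a² + b².
  have hsq : ∀ ω, (∫ a, Φ (a, ω) ∂μ) ^ 2 =
      ∫ q, Φ (q.1, ω) * Φ (q.2, ω) ∂μ.prod μ := fun ω => by
    rw [sq, ← integral_prod_mul]
  have h1 : Integrable (fun r : (α × α) × Ω => Φ (r.1.1, r.2) ^ 2) ((μ.prod μ).prod P) := by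
    have h2 : Integrable (fun r : α × (α × Ω) => (1 : ℝ) * Φ r.2 ^ 2) (μ.prod (μ.prod P)) :=
      (integrable_const (1 : ℝ)).mul_prod hΦ2
    have h3 : MeasurePreserving (fun r : (α × α) × Ω => (r.1.2, (r.1.1, r.2)))
        ((μ.prod μ).prod P) (μ.prod (μ.prod P)) :=
      (measurePreserving_prodAssoc μ μ P).comp
        ((Measure.measurePreserving_swap (μ := μ) (ν := μ)).prod (MeasurePreserving.id P))
    simpa [Function.comp_def] using h3.integrable_comp_of_integrable h2
  have h1' : Integrable (fun r : (α × α) × Ω => Φ (r.1.2, r.2) ^ 2) ((μ.prod μ).prod P) := by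
    have h3 : MeasurePreserving (fun r : (α × α) × Ω => (r.1.swap, r.2))
        ((μ.prod μ).prod P) ((μ.prod μ).prod P) :=
      (Measure.measurePreserving_swap (μ := μ) (ν := μ)).prod (MeasurePreserving.id P)
    exact h3.integrable_comp_of_integrable h1
  have h4 : Integrable (fun r : (α × α) × Ω => Φ (r.1.1, r.2) * Φ (r.1.2, r.2))
      ((μ.prod μ).prod P) := by
    refine (h1.add h1').mono' (by fun_prop) (ae_of_all _ fun r => ?_)
    simp only [Pi.add_apply, Real.norm_eq_abs]
    rw [abs_le]
    constructor <;> nlinarith [sq_nonneg (Φ (r.1.1, r.2) - Φ (r.1.2, r.2)),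
      sq_nonneg (Φ (r.1.1, r.2) + Φ (r.1.2, r.2))]
  simp only [hsq]
  refine ⟨h4.integral_prod_right, ?_⟩
  rw [← integral_integral_swap (f := fun (q : α × α) ω => Φ (q.1, ω) * Φ (q.2, ω)) h4]
  refine integral_mono_ae h4.integral_prod_left hB ?_
  filter_upwards [hΦB] with q hq using (le_abs_self _).trans hq

/-- Random variables with summable second moments tend to zero almost surely. -/
lemma ae_tendsto_zero_of_summable_integral_sq {X : ℕ → Ω → ℝ}
    (hX : ∀ n, Integrable (fun ω => X n ω ^ 2) P) (hm : ∀ n, AEMeasurable (X n) P) {b : ℕ → ℝ}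
    (hb : Summable b) (h : ∀ n, ∫ ω, X n ω ^ 2 ∂P ≤ b n) :
    ∀ᵐ ω ∂P, Tendsto (fun n => X n ω) atTop (𝓝 0) := by
  -- The sum of the squares has finite expectation, so it is almost surely finite and its terms tend
  -- to 0.
  have h1 : ∫⁻ ω, ∑' n, ENNReal.ofReal (X n ω ^ 2) ∂P ≠ ∞ := by
    rw [lintegral_tsum fun n => ((hm n).pow_const 2).ennreal_ofReal]
    refine ne_top_of_le_ne_top hb.tsum_ofReal_ne_top (ENNReal.tsum_le_tsum fun n => ?_)
    rw [← ofReal_integral_eq_lintegral_ofReal (hX n) (ae_of_all _ fun ω => sq_nonneg _)]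
    exact ENNReal.ofReal_le_ofReal (h n)
  have h2 := ae_lt_top' (AEMeasurable.tsum fun n => ((hm n).pow_const 2).ennreal_ofReal) h1
  filter_upwards [h2] with ω hω
  have h3 := ENNReal.tendsto_atTop_zero_of_tsum_ne_top hω.ne
  have h4 := (ENNReal.tendsto_toReal ENNReal.zero_ne_top).comp h3
  have h5 : Tendsto (fun n => X n ω ^ 2) atTop (𝓝 0) := by
    refine h4.congr fun n => ?_
    simp [ENNReal.toReal_ofReal (sq_nonneg (X n ω))]
  have h6 := (Real.continuous_sqrt.tendsto 0).comp h5
  rw [Real.sqrt_zero] at h6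
  refine (tendsto_zero_iff_abs_tendsto_zero _).2 (h6.congr fun n => ?_)
  simp [Real.sqrt_sq_eq_abs]

end SecondMoment

/-! ### Increments in L^q and the reduction of Besov regularity to dyadic steps. -/

/-- The points of `[0, 1]` that remain there after a shift by `s`. -/
def shiftDomain (s : ℝ) : Set ℝ := {x | x ∈ Icc (0 : ℝ) 1 ∧ x + s ∈ Icc (0 : ℝ) 1}

/-- The `L^q` norm of the increments of `f` over steps of size `s`. -/
noncomputable def shiftNorm (q : ℝ≥0∞) (f : ℝ → ℝ) (s : ℝ) : ℝ≥0∞ :=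
  eLpNorm (fun x => f (x + s) - f x) q (volume.restrict (shiftDomain s))

lemma measurableSet_shiftDomain (s : ℝ) : MeasurableSet (shiftDomain s) :=
  measurableSet_Icc.inter ((measurable_add_const s) measurableSet_Icc)

lemma lpModulus_eq (q : ℝ≥0∞) (f : ℝ → ℝ) (t : ℝ) :
    lpModulus q (Icc 0 1) f t = ⨆ (s : ℝ) (_ : |s| ≤ t), shiftNorm q f s := rfl

/-- Translation preserves null sets, so the equality also holds almost everywhere at the shifted
point. This permits replacing a path by a Borel version. -/
lemma shiftNorm_congr {q : ℝ≥0∞} {f g : ℝ → ℝ} (h : f =ᵐ[volume.restrict (Icc 0 1)] g) (s : ℝ) :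
    shiftNorm q f s = shiftNorm q g s := by
  have h1 : ∀ᵐ x : ℝ, x ∈ Icc (0 : ℝ) 1 → f x = g x := (ae_restrict_iff' measurableSet_Icc).1 h
  have h2 : ∀ᵐ x : ℝ, x + s ∈ Icc (0 : ℝ) 1 → f (x + s) = g (x + s) :=
    (measurePreserving_add_right volume s).quasiMeasurePreserving.ae h1
  refine eLpNorm_congr_ae ((ae_restrict_iff' (measurableSet_shiftDomain s)).2 ?_)
  filter_upwards [h1, h2] with x hx hx' hxs
  rw [hx hxs.1, hx' hxs.2]

lemma eLpNorm_shift_le {q : ℝ≥0∞} {g : ℝ → ℝ} (hg : Measurable g) {A B : Set ℝ}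
    (hB : MeasurableSet B) (a : ℝ) (hAB : ∀ x ∈ A, x + a ∈ B) :
    eLpNorm (fun x => g (x + a)) q (volume.restrict A) ≤ eLpNorm g q (volume.restrict B) := by
  have h := eLpNorm_comp_measurePreserving (p := q) hg.aestronglyMeasurable
    ((measurePreserving_add_right volume a).restrict_preimage hB)
  rw [← h]
  exact eLpNorm_mono_measure _ (Measure.restrict_mono hAB le_rfl)

section

variable {q : ℝ≥0∞} {g : ℝ → ℝ}

/-- The substitution x ↦ x - s exchanges the two endpoints of the increment. -/
lemma shiftNorm_neg_le (hg : Measurable g) (s : ℝ) : shiftNorm q g (-s) ≤ shiftNorm q g s := by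
  have h := eLpNorm_shift_le (q := q) (g := fun x => g (x + s) - g x) (by fun_prop)
    (measurableSet_shiftDomain s) (A := shiftDomain (-s)) (-s)
    (fun x hx => ⟨hx.2, by simpa using hx.1⟩)
  refine le_trans (le_of_eq ?_) h
  rw [shiftNorm, ← eLpNorm_neg]
  congr 1
  ext x
  simp

lemma shiftNorm_abs (hg : Measurable g) (s : ℝ) : shiftNorm q g |s| = shiftNorm q g s := by
  rcases abs_choice s with h | h
  · rw [h]
  · rw [h]
    refine le_antisymm (shiftNorm_neg_le hg s) ?_
    simpa using shiftNorm_neg_le (q := q) hg (-s)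

/-- Triangle inequality through the intermediate point x + a, which stays in [0, 1] because a and b
have the same sign. -/
lemma shiftNorm_add_le (hg : Measurable g) (hq : 1 ≤ q) {a b : ℝ} (ha : 0 ≤ a) (hb : 0 ≤ b) :
    shiftNorm q g (a + b) ≤ shiftNorm q g a + shiftNorm q g b := by
  have e : (fun x => g (x + (a + b)) - g x) =
      (fun x => g (x + a) - g x) + fun x => g (x + a + b) - g (x + a) := by
    ext x; simp [add_assoc]
  rw [shiftNorm, e]
  refine (eLpNorm_add_le (by fun_prop) (by fun_prop) hq).trans (add_le_add ?_ ?_)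
  · refine eLpNorm_mono_measure _ (Measure.restrict_mono ?_ le_rfl)
    intro x hx
    have h : x + (a + b) ≤ 1 := hx.2.2
    exact ⟨hx.1, by linarith [hx.1.1], by linarith⟩
  · refine eLpNorm_shift_le (g := fun x => g (x + b) - g x) (by fun_prop)
      (measurableSet_shiftDomain b) a ?_
    intro x hx
    have h : x + (a + b) ≤ 1 := hx.2.2
    refine ⟨⟨by linarith [hx.1.1], by linarith⟩, ?_⟩
    rw [add_assoc]
    exact hx.2

lemma shiftNorm_le (hg : Measurable g) (hq : 1 ≤ q) (s : ℝ) :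
    shiftNorm q g s ≤ 2 * eLpNorm g q (volume.restrict (Icc 0 1)) := by
  rw [two_mul]
  refine (eLpNorm_sub_le (by fun_prop : Measurable fun x => g (x + s)).aestronglyMeasurable
    hg.aestronglyMeasurable hq).trans (add_le_add ?_ ?_)
  · exact eLpNorm_shift_le hg measurableSet_Icc s fun x hx => hx.2
  · exact eLpNorm_mono_measure _ (Measure.restrict_mono (fun x hx => hx.1) le_rfl)

/-- Translations are continuous in `L^q`. -/
lemma tendsto_shiftNorm_zero (hq : 1 ≤ q) (hq' : q ≠ ∞)
    (hL : MemLp g q (volume.restrict (Icc 0 1))) :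
    Tendsto (shiftNorm q g) (𝓝 0) (𝓝 0) := by
  have : Fact (1 ≤ q) := ⟨hq⟩
  have : Fact (q ≠ ∞) := ⟨hq'⟩
  -- Extended by zero, `g` gives an element of L^q(ℝ), where translations act continuously;
  -- restricting to `shiftDomain s` only decreases the norm.
  set k := (Icc (0 : ℝ) 1).indicator g with hk
  have hkL : MemLp k q volume := (memLp_indicator_iff_restrict measurableSet_Icc).2 hL
  have h1 : Continuous fun s : ℝ => DomAddAct.mk s +ᵥ hkL.toLp k :=
    (DomAddAct.continuous_mk).vadd continuous_const
  have h2 := (h1.tendsto 0).edist (tendsto_const_nhds (x := hkL.toLp k))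
  simp only [DomAddAct.mk_zero, zero_vadd, edist_self] at h2
  refine tendsto_of_tendsto_of_tendsto_of_le_of_le tendsto_const_nhds h2 (fun s => zero_le)
    fun s => ?_
  simp only [DomAddAct.mk_vadd_toLp, Lp.edist_toLp_toLp]
  have hgk : g =ᵐ[volume.restrict (Icc 0 1)] k := by
    filter_upwards [ae_restrict_mem measurableSet_Icc] with x hx
    rw [hk, indicator_of_mem hx]
  rw [shiftNorm_congr hgk]
  refine (eLpNorm_mono_measure _ Measure.restrict_le_self).trans_eq ?_
  congr 1
  ext x
  simp [add_comm]

/-- Greedy binary expansion of t: each dyadic step is subtracted if it fits, and t' is what remains.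
Steps that do not fit stay in the sum, which only enlarges the bound. -/
lemma exists_shiftNorm_remainder (hg : Measurable g) (hq : 1 ≤ q) (n N : ℕ) {t : ℝ} (ht : 0 ≤ t)
    (htn : t ≤ (1 / 2) ^ n) : ∃ t', 0 ≤ t' ∧ t' ≤ (1 / 2) ^ (n + N) ∧ shiftNorm q g t ≤
      ∑ i ∈ Finset.range N, shiftNorm q g ((1 / 2) ^ (n + i + 1)) + shiftNorm q g t' := by
  induction N with
  | zero => exact ⟨t, ht, htn, by simp⟩
  | succ N ih =>
    obtain ⟨t', h0, h1, h2⟩ := ih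
    have hh : ((1 : ℝ) / 2) ^ (n + N) = 2 * (1 / 2) ^ (n + N + 1) := by rw [pow_succ]; ring
    rw [Finset.sum_range_succ, ← add_assoc n N 1]
    rcases le_total t' ((1 / 2) ^ (n + N + 1)) with h | h
    · refine ⟨t', h0, h, h2.trans ?_⟩
      rw [add_assoc]
      gcongr
      exact le_add_self
    · refine ⟨t' - (1 / 2) ^ (n + N + 1), sub_nonneg.2 h, by linarith, h2.trans ?_⟩
      rw [add_assoc]
      gcongr
      have := shiftNorm_add_le (q := q) hg hq (a := (1 / 2) ^ (n + N + 1)) (by positivity)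
        (sub_nonneg.2 h)
      rwa [add_sub_cancel] at this

/-- If the increments over dyadic steps are bounded by a geometric sequence, so are those over all
smaller steps. -/
lemma shiftNorm_le_of_dyadic (hg : Measurable g) (hq : 1 ≤ q) (hq' : q ≠ ∞)
    (hL : MemLp g q (volume.restrict (Icc 0 1))) {C r : ℝ≥0∞} {n₀ : ℕ}
    (h : ∀ n ≥ n₀, shiftNorm q g ((1 / 2) ^ n) ≤ C * r ^ n) {n : ℕ} (hn : n₀ ≤ n) {t : ℝ}
    (ht : 0 ≤ t) (htn : t ≤ (1 / 2) ^ n) : shiftNorm q g t ≤ C * r ^ (n + 1) * (1 - r)⁻¹ := by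
  choose t' h0 h1 h2 using fun N => exists_shiftNorm_remainder (q := q) hg hq n N ht htn
  have h3 : Tendsto t' atTop (𝓝 0) := by
    have h4 : Tendsto (fun N => ((1 : ℝ) / 2) ^ (n + N)) atTop (𝓝 0) :=
      (tendsto_pow_atTop_nhds_zero_of_lt_one (by norm_num) (by norm_num)).comp
        (tendsto_atTop_mono (fun N => Nat.le_add_left N n) tendsto_id)
    exact squeeze_zero h0 h1 h4
  have h5 := (tendsto_const_nhds (x := C * r ^ (n + 1) * (1 - r)⁻¹)).add
    ((tendsto_shiftNorm_zero hq hq' hL).comp h3)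
  rw [add_zero] at h5
  refine ge_of_tendsto' h5 fun N => (h2 N).trans ?_
  refine add_le_add ?_ le_rfl
  calc ∑ i ∈ Finset.range N, shiftNorm q g ((1 / 2) ^ (n + i + 1))
      ≤ ∑ i ∈ Finset.range N, C * r ^ (n + 1) * r ^ i := by
        refine Finset.sum_le_sum fun i _ => (h _ (by omega)).trans_eq ?_
        rw [mul_assoc, ← pow_add]
        congr 2
        omega
    _ = C * r ^ (n + 1) * ∑ i ∈ Finset.range N, r ^ i := by rw [Finset.mul_sum]
    _ ≤ C * r ^ (n + 1) * (1 - r)⁻¹ := by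
        rw [← ENNReal.tsum_geometric]
        gcongr
        exact ENNReal.sum_le_tsum _

lemma ofReal_rpow_half_pow (n : ℕ) : ENNReal.ofReal (((1 / 2 : ℝ) ^ n) ^ (1 / 2 : ℝ)) =
    ENNReal.ofReal ((1 / 2 : ℝ) ^ (1 / 2 : ℝ)) ^ n := by
  rw [← ENNReal.ofReal_pow (by positivity), ← Real.rpow_natCast, ← Real.rpow_natCast,
    ← Real.rpow_mul (by norm_num), ← Real.rpow_mul (by norm_num), mul_comm]

end

/-- A function whose increments over small dyadic steps `s` are of order `s ^ (1 / 2)` in `L^q` is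
in the Besov space of order `1 / 2`. -/
theorem mem_besov_of_dyadic {q : ℝ≥0∞} (hq : 1 ≤ q) (hq' : q ≠ ∞) {f : ℝ → ℝ}
    (hf : MemLp f q (volume.restrict (Icc 0 1))) {C : ℝ≥0∞} (hC : C ≠ ∞) {n₀ : ℕ}
    (h : ∀ n ≥ n₀, shiftNorm q f ((1 / 2) ^ n) ≤
      C * ENNReal.ofReal (((1 / 2 : ℝ) ^ n) ^ (1 / 2 : ℝ))) :
    f ∈ besov (1 / 2) q (Icc 0 1) := by
  obtain ⟨g, hgm, hfg⟩ := hf.1.aemeasurable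
  have hg : MemLp g q (volume.restrict (Icc 0 1)) := hf.ae_eq hfg
  set r := ENNReal.ofReal ((1 / 2 : ℝ) ^ (1 / 2 : ℝ)) with hr
  have hr0 : r ≠ 0 := by rw [hr, Ne, ENNReal.ofReal_eq_zero, not_le]; positivity
  have hr1 : r < 1 := by
    rw [hr, ENNReal.ofReal_lt_one]
    exact Real.rpow_lt_one (by norm_num) (by norm_num) (by norm_num)
  have hrt : r ≠ ∞ := ENNReal.ofReal_ne_top
  simp only [ofReal_rpow_half_pow, shiftNorm_congr hfg] at h
  -- `K` comes from the geometric series over binary digits at scales n ≥ n₀; `L` covers the coarser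
  -- scales, where the trivial bound by twice the norm is compared with r ^ n₀.
  set K := C * (1 - r)⁻¹ with hK
  have hKt : K ≠ ∞ :=
    ENNReal.mul_ne_top hC (ENNReal.inv_ne_top.2 (tsub_pos_iff_lt.2 hr1).ne')
  set L := 2 * eLpNorm g q (volume.restrict (Icc 0 1)) / r ^ n₀ with hL
  have hLt : L ≠ ∞ := ENNReal.div_ne_top (ENNReal.mul_ne_top (by simp) hg.2.ne) (pow_ne_zero _ hr0)
  refine ⟨hf, ENNReal.add_lt_top.2 ⟨hf.2, lt_of_le_of_lt (iSup₂_le fun t ht => ?_)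
    (ENNReal.add_lt_top.2 ⟨hKt.lt_top, hLt.lt_top⟩)⟩⟩
  -- The scale n satisfies 2^(-(n+1)) < t ≤ 2^(-n).
  obtain ⟨n, hn1, hn2⟩ := exists_nat_pow_near_of_lt_one ht.1 ht.2 (by norm_num : (0 : ℝ) < 1 / 2)
    (by norm_num)
  have ht1 : r ^ (n + 1) ≤ ENNReal.ofReal (t ^ (1 / 2 : ℝ)) := by
    rw [← ofReal_rpow_half_pow]
    exact ENNReal.ofReal_le_ofReal (Real.rpow_le_rpow (by positivity) hn1.le (by norm_num))
  have ht0 : ENNReal.ofReal (t ^ (1 / 2 : ℝ)) ≠ 0 := by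
    rw [Ne, ENNReal.ofReal_eq_zero, not_le]
    exact Real.rpow_pos_of_pos ht.1 _
  rw [ENNReal.div_le_iff ht0 ENNReal.ofReal_ne_top, lpModulus_eq]
  refine iSup₂_le fun s hs => ?_
  rw [shiftNorm_congr hfg, ← shiftNorm_abs hgm]
  rcases le_or_gt n₀ n with hn | hn
  · calc shiftNorm q g |s| ≤ C * r ^ (n + 1) * (1 - r)⁻¹ :=
          shiftNorm_le_of_dyadic hgm hq hq' hg h hn (abs_nonneg s) (hs.trans hn2)
      _ = K * r ^ (n + 1) := by rw [hK]; ring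
      _ ≤ (K + L) * ENNReal.ofReal (t ^ (1 / 2 : ℝ)) := mul_le_mul' le_self_add ht1
  · calc shiftNorm q g |s| ≤ 2 * eLpNorm g q (volume.restrict (Icc 0 1)) := shiftNorm_le hgm hq _
      _ = L * r ^ n₀ := (ENNReal.div_mul_cancel (pow_ne_zero _ hr0) (ENNReal.pow_ne_top hrt)).symm
      _ ≤ L * r ^ (n + 1) := by
          exact mul_le_mul_right (pow_le_pow_right_of_le_one' hr1.le hn) L
      _ ≤ (K + L) * ENNReal.ofReal (t ^ (1 / 2 : ℝ)) := mul_le_mul' le_add_self ht1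

/-- A function whose increments over small dyadic steps `s` are bounded below by a multiple of
`s ^ (1 / 2)` in `L^q` is not in the little Besov space of order `1 / 2`. -/
theorem notMem_littleBesov_of_dyadic {q : ℝ≥0∞} {f : ℝ → ℝ} {c : ℝ≥0∞} (hc : c ≠ 0) {n₀ : ℕ}
    (h : ∀ n ≥ n₀, c * ENNReal.ofReal (((1 / 2 : ℝ) ^ n) ^ (1 / 2 : ℝ)) ≤
      shiftNorm q f ((1 / 2) ^ n)) :
    f ∉ littleBesov (1 / 2) q (Icc 0 1) := by
  rintro ⟨-, hf⟩
  have h1 : Tendsto (fun n : ℕ => ((1 : ℝ) / 2) ^ n) atTop (𝓝[>] 0) :=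
    tendsto_pow_atTop_nhdsWithin_zero_of_lt_one (by norm_num) (by norm_num)
  refine hc (le_antisymm (ge_of_tendsto (hf.comp h1) ?_) zero_le)
  filter_upwards [eventually_ge_atTop n₀] with n hn
  have h0 : ENNReal.ofReal (((1 / 2 : ℝ) ^ n) ^ (1 / 2 : ℝ)) ≠ 0 := by
    rw [Ne, ENNReal.ofReal_eq_zero, not_le]; positivity
  rw [Function.comp_apply, ENNReal.le_div_iff_mul_le (Or.inl h0) (Or.inl ENNReal.ofReal_ne_top),
    lpModulus_eq]
  exact (h n hn).trans (le_iSup₂_of_le ((1 / 2) ^ n) (abs_of_pos (by positivity)).le le_rfl)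

/-! ### Normalized increments as Wiener integrals, and their correlations. -/

section Increments

/-- The spatial increment over a step of size `s`, divided by its standard deviation. -/
noncomputable def normIncrement {Ω : Type*} (U : ℝ → Ω → ℝ) (t s x : ℝ) (ω : Ω) : ℝ :=
  (√(incrementCov t s 0))⁻¹ * (U (x + s) ω - U x ω)

/-- The correlation of two spatial increments over steps of size `s`. -/
noncomputable def incrementCorr (t s z : ℝ) : ℝ := incrementCov t s z / incrementCov t s 0

/-- The integrand of the Wiener integral `normIncrement`. -/
noncomputable def incrementKernel (t s x : ℝ) (q : ℝ × ℝ) : ℝ :=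
  (√(incrementCov t s 0))⁻¹ * (mildKernel t (x + s) q - mildKernel t x q)

lemma integral_incrementKernel_mul {t s : ℝ} (ht : 0 ≤ t) (hs : 0 < incrementCov t s 0)
    (hk : ∀ x, MemLp (mildKernel t x) 2 volume) (x y : ℝ) :
    ∫ q, incrementKernel t s x q * incrementKernel t s y q = incrementCorr t s (x - y) := by
  have hi : ∀ a b, Integrable (fun q => mildKernel t a q * mildKernel t b q) volume :=
    fun a b => (hk a).integrable_mul (hk b)
  have e : ∀ q, incrementKernel t s x q * incrementKernel t s y q =
      (incrementCov t s 0)⁻¹ * ((mildKernel t (x + s) q * mildKernel t (y + s) q +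
        mildKernel t x q * mildKernel t y q) - (mildKernel t (x + s) q * mildKernel t y q +
        mildKernel t x q * mildKernel t (y + s) q)) := by
    intro q
    rw [incrementKernel, incrementKernel, mul_mul_mul_comm, ← mul_inv, Real.mul_self_sqrt hs.le]
    ring
  simp only [e]
  have hi2 : ∀ a b c d, Integrable (fun q => mildKernel t a q * mildKernel t b q +
      mildKernel t c q * mildKernel t d q) volume := fun a b c d => (hi a b).add (hi c d)
  rw [integral_const_mul, integral_sub (hi2 _ _ _ _) (hi2 _ _ _ _),
    integral_add (hi _ _) (hi _ _), integral_add (hi _ _) (hi _ _)]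
  simp only [integral_mildKernel_mul ht (hk _) (hk _)]
  have h : incrementCov t s (x - y) = 2 * greenPotential t (x - y) -
    greenPotential t (x - y + s) - greenPotential t (x - y - s) := rfl
  rw [incrementCorr, h, show x + s - (y + s) = x - y by ring,
    show x + s - y = x - y + s by ring, show x - (y + s) = x - y - s by ring]
  ring

variable {Ω : Type*} [MeasurableSpace Ω] {P : Measure Ω} {W : ℝ≥0 × BoundedBorel → Ω → ℝ}
  {t s : ℝ} {U : ℝ → Ω → ℝ}

lemma isWienerIntegral_normIncrement (hW : IsWhiteNoise W P)
    (hU : ∀ x, IsWienerIntegral W P (mildKernel t x) (U x)) (x : ℝ) :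
    IsWienerIntegral W P (incrementKernel t s x) (normIncrement U t s x) := by
  have h := (hU (x + s)).add_smul hW (hU x) (√(incrementCov t s 0))⁻¹ (-(√(incrementCov t s 0))⁻¹)
  have e1 : incrementKernel t s x = fun q => (√(incrementCov t s 0))⁻¹ * mildKernel t (x + s) q +
      -(√(incrementCov t s 0))⁻¹ * mildKernel t x q := by
    ext q; simp only [incrementKernel]; ring
  have e2 : normIncrement U t s x = fun ω => (√(incrementCov t s 0))⁻¹ * U (x + s) ω +
      -(√(incrementCov t s 0))⁻¹ * U x ω := by
    ext ω; simp only [normIncrement]; ring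
  rwa [e1, e2]

lemma incrementCorr_zero (hs : 0 < incrementCov t s 0) : incrementCorr t s 0 = 1 :=
  div_self hs.ne'

lemma map_normIncrement (hW : IsWhiteNoise W P)
    (hU : ∀ x, IsWienerIntegral W P (mildKernel t x) (U x)) (ht : 0 ≤ t)
    (hs : 0 < incrementCov t s 0) (x : ℝ) :
    P.map (normIncrement U t s x) = gaussianReal 0 1 := by
  rw [(isWienerIntegral_normIncrement hW hU x).map_eq hW]
  simp only [sq]
  rw [integral_incrementKernel_mul ht hs (fun x => (hU x).1), sub_self, incrementCorr_zero hs,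
    Real.toNNReal_one]

/-- The correlation of the `p`-th powers of two increments is bounded by a multiple of the
correlation of the increments. -/
lemma abs_integral_normIncrement_le (hW : IsWhiteNoise W P)
    (hU : ∀ x, IsWienerIntegral W P (mildKernel t x) (U x)) (ht : 0 ≤ t)
    (hs : 0 < incrementCov t s 0) {p : ℝ} (hp : 1 ≤ p) (x y : ℝ) :
    |incrementCorr t s (y - x)| ≤ 1 ∧
    |∫ ω, (|normIncrement U t s x ω| ^ p - gaussMoment p) *
      (|normIncrement U t s y ω| ^ p - gaussMoment p) ∂P| ≤
      covConst p * |incrementCorr t s (y - x)| := by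
  have := hW.isGaussianProcess.isProbabilityMeasure
  set ρ := incrementCorr t s (y - x) with hρ
  have hX := isWienerIntegral_normIncrement (s := s) hW hU x
  have hY := isWienerIntegral_normIncrement (s := s) hW hU y
  have hk := fun x => (hU x).1
  have hZ := hY.add_smul hW hX 1 (-ρ)
  have hixx := integral_incrementKernel_mul ht hs hk x x
  have hiyy := integral_incrementKernel_mul ht hs hk y y
  have hiyx := integral_incrementKernel_mul ht hs hk y x
  have hixy : ∫ q, incrementKernel t s x q * incrementKernel t s y q = ρ := by
    rw [hρ, ← hiyx]
    exact integral_congr_ae (ae_of_all _ fun q => mul_comm _ _)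
  rw [sub_self, incrementCorr_zero hs] at hixx hiyy
  -- The residual of y after projection on x is orthogonal to x; for Wiener integrals this is the
  -- independence required by `abs_integral_centered_mul_le`.
  have horth : ∫ q, incrementKernel t s x q *
      (1 * incrementKernel t s y q + -ρ * incrementKernel t s x q) = 0 := by
    have e : ∀ q, incrementKernel t s x q *
        (1 * incrementKernel t s y q + -ρ * incrementKernel t s x q) =
        incrementKernel t s x q * incrementKernel t s y q -
          ρ * (incrementKernel t s x q * incrementKernel t s x q) := fun q => by ring
    have h1 : Integrable (fun q => incrementKernel t s x q * incrementKernel t s y q) volume :=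
      hX.1.integrable_mul hY.1
    have h2 : Integrable (fun q => ρ * (incrementKernel t s x q * incrementKernel t s x q)) volume :=
      (hX.1.integrable_mul hX.1).const_mul ρ
    simp only [e]
    rw [integral_sub h1 h2, integral_const_mul, hixx, hixy, mul_one, sub_self]
  -- 1 - ρ² is the squared norm of that residual.
  have hvar : 0 ≤ 1 - ρ ^ 2 := by
    have h0 : 0 ≤ ∫ q, (incrementKernel t s y q + -ρ * incrementKernel t s x q) ^ 2 :=
      integral_nonneg fun q => sq_nonneg _
    rw [integral_add_sq hY.1 (hX.1.const_mul (-ρ))] at h0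
    have e1 : ∫ q, incrementKernel t s y q * (-ρ * incrementKernel t s x q) = -ρ * ρ := by
      rw [hρ, ← hiyx, ← integral_const_mul]
      exact integral_congr_ae (ae_of_all _ fun q => by simp only [hiyx]; ring)
    have e2 : ∫ q, (-ρ * incrementKernel t s x q) ^ 2 = ρ ^ 2 := by
      rw [← mul_one (ρ ^ 2), ← hixx, ← integral_const_mul]
      exact integral_congr_ae (ae_of_all _ fun q => by simp only; ring)
    have e3 : ∫ q, incrementKernel t s y q ^ 2 = 1 := by simpa only [sq] using hiyy
    rw [e1, e2, e3] at h0
    linarith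
  have hρ1 : |ρ| ≤ 1 := (sq_le_one_iff_abs_le_one ρ).1 (by linarith)
  refine ⟨hρ1, abs_integral_centered_mul_le hp hρ1 hX.2.1.1.aemeasurable hY.2.1.1.aemeasurable
    (map_normIncrement hW hU ht hs x) (map_normIncrement hW hU ht hs y) ?_⟩
  have h := hX.indepFun hW hZ horth
  have e : (fun ω => 1 * normIncrement U t s y ω + -ρ * normIncrement U t s x ω) =
      fun ω => normIncrement U t s y ω - ρ * normIncrement U t s x ω := by
    ext ω; ring
  rwa [e] at h

end Increments

/-! ### The integrated power variation and its variance. -/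

section JointMeasurability

variable {α Ω : Type*} [MeasurableSpace α] [MeasurableSpace Ω] {μ : Measure α} {P : Measure Ω}

/-- A function of a measurable random field whose variables have a common law is integrable if it is
integrable under that law. -/
lemma integrable_comp_of_map_eq [IsFiniteMeasure μ] [IsProbabilityMeasure P] {V : α × Ω → ℝ}
    (hV : Measurable V) {ν : Measure ℝ} (hν : ∀ᵐ x ∂μ, P.map (fun ω => V (x, ω)) = ν) {F : ℝ → ℝ}
    (hF : Measurable F) (hFν : Integrable F ν) :
    Integrable (fun q => F (V q)) (μ.prod P) := by
  refine (integrable_prod_iff (hF.comp hV).aestronglyMeasurable).2 ⟨?_, ?_⟩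
  · filter_upwards [hν] with x hx
    rw [← hx] at hFν
    exact hFν.comp_measurable (by fun_prop)
  · refine (integrable_const (∫ z, ‖F z‖ ∂ν)).congr ?_
    filter_upwards [hν] with x hx
    rw [← hx, integral_map (by fun_prop) hF.norm.aestronglyMeasurable]
    rfl

end JointMeasurability

lemma integrable_centered_sq {p : ℝ} (hp : 0 < p) (m : ℝ) :
    Integrable (fun z => (|z| ^ p - m) ^ 2) (gaussianReal 0 1) := by
  have h := ((integrable_abs_rpow_gaussianReal (p := 2 * p) (by linarith)).sub
    ((integrable_abs_rpow_gaussianReal hp).const_mul (2 * m))).add (integrable_const (m ^ 2))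
  refine h.congr (ae_of_all _ fun z => ?_)
  have : |z| ^ (2 * p) = (|z| ^ p) ^ 2 := by
    rw [mul_comm, Real.rpow_mul (abs_nonneg z)]; norm_cast
  simp only [Pi.add_apply, Pi.sub_apply, this]
  ring

lemma volume_real_shiftDomain {s : ℝ} (hs : 0 ≤ s) (hs1 : s ≤ 1) :
    volume.real (shiftDomain s) = 1 - s := by
  have : shiftDomain s = Icc 0 (1 - s) := by
    ext x
    simp only [shiftDomain, mem_Icc, mem_ofPred_eq]
    constructor
    · rintro ⟨⟨h1, h2⟩, h3, h4⟩; exact ⟨h1, by linarith⟩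
    · rintro ⟨h1, h2⟩; exact ⟨⟨h1, by linarith⟩, by linarith, by linarith⟩
  rw [this, Real.volume_real_Icc_of_le (by linarith)]
  ring

instance isFiniteMeasure_restrict_shiftDomain (s : ℝ) :
    IsFiniteMeasure (volume.restrict (shiftDomain s)) :=
  ⟨by
    rw [Measure.restrict_apply_univ]
    exact (measure_mono (fun x hx => hx.1)).trans_lt
      (measure_Icc_lt_top (a := (0 : ℝ)) (b := 1))⟩

/-- The square has measure at most 1 and the band around the diagonal at most 2s. The constant d
serves the close pairs, whose correlation is only bounded by 1, and c the distant ones. -/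
lemma integral_near_diagonal_le {s c d : ℝ} (hs : 0 ≤ s) (hs1 : s ≤ 1) (hc : 0 ≤ c) (hd : 0 ≤ d) :
    Integrable (fun q : ℝ × ℝ => c + {q : ℝ × ℝ | |q.2 - q.1| < s}.indicator (fun _ => d) q)
      ((volume.restrict (shiftDomain s)).prod (volume.restrict (shiftDomain s))) ∧
    ∫ q, (c + {q : ℝ × ℝ | |q.2 - q.1| < s}.indicator (fun _ => d) q)
      ∂((volume.restrict (shiftDomain s)).prod (volume.restrict (shiftDomain s))) ≤
        c + 2 * s * d := by
  set μ := volume.restrict (shiftDomain s) with hμ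
  have hA : MeasurableSet {q : ℝ × ℝ | |q.2 - q.1| < s} :=
    measurableSet_lt (by fun_prop) measurable_const
  have hi : Integrable ({q : ℝ × ℝ | |q.2 - q.1| < s}.indicator fun _ => d) (μ.prod μ) :=
    (integrable_const d).indicator hA
  have hu : μ.real univ ≤ 1 := by
    rw [hμ, measureReal_restrict_apply MeasurableSet.univ, univ_inter,
      volume_real_shiftDomain hs hs1]
    linarith
  have hu0 : 0 ≤ μ.real univ := measureReal_nonneg
  refine ⟨(integrable_const c).add hi, ?_⟩
  rw [integral_add (integrable_const c) hi, integral_const, integral_indicator_const _ hA,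
    ← univ_prod_univ, measureReal_prod_prod, smul_eq_mul, smul_eq_mul]
  have h1 : (μ.prod μ).real {q : ℝ × ℝ | |q.2 - q.1| < s} ≤ 2 * s := by
    refine ENNReal.toReal_le_of_le_ofReal (by positivity) ?_
    rw [Measure.prod_apply hA]
    have h2 : ∀ x : ℝ, μ (Prod.mk x ⁻¹' {q : ℝ × ℝ | |q.2 - q.1| < s}) ≤
        ENNReal.ofReal (2 * s) := fun x => by
      refine (Measure.restrict_apply_le _ _).trans ?_
      rw [← Real.volume_ball x s]
      exact measure_mono fun y hy => hy
    refine (lintegral_mono h2).trans ?_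
    rw [lintegral_const]
    refine mul_le_of_le_one_right' ?_
    rw [← ENNReal.ofReal_toReal (measure_ne_top μ univ), ← ENNReal.ofReal_one]
    exact ENNReal.ofReal_le_ofReal hu
  have h3 : μ.real univ * μ.real univ * c ≤ 1 * c := by gcongr; nlinarith
  have h4 := mul_le_mul_of_nonneg_right h1 hd
  linarith

section Path

variable {Ω : Type*} [MeasurableSpace Ω] {P : Measure Ω} {W : ℝ≥0 × BoundedBorel → Ω → ℝ}
  {t : ℝ} {U : ℝ → Ω → ℝ}

/-- The variance of the integrated `p`-th power of the increments over steps of size `s` is of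
order `s`. -/
lemma integral_sq_centered_power_variation_le (hW : IsWhiteNoise W P) (ht : 0 < t)
    (hU : ∀ x, IsWienerIntegral W P (mildKernel t x) (U x)) {V : ℝ × Ω → ℝ} (hV : Measurable V)
    (hUV : ∀ᵐ x, ∀ᵐ ω ∂P, U x ω = V (x, ω)) {p : ℝ} (hp : 1 ≤ p) {M s : ℝ} (hM : 0 < M)
    (hs : 0 < s) (hs1 : s ≤ 1) (hMs : M * s ≤ 1 / 2) (h0 : |incrementCov t s 0 - s| ≤ M * s ^ 2)
    (hfar : ∀ z, s ≤ |z| → |incrementCov t s z| ≤ M * s ^ 2) :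
    Integrable (fun q : ℝ × Ω => |normIncrement (fun x ω => V (x, ω)) t s q.1 q.2| ^ p)
      ((volume.restrict (shiftDomain s)).prod P) ∧
    Integrable (fun ω => (∫ x in shiftDomain s,
      (|normIncrement (fun x ω => V (x, ω)) t s x ω| ^ p - gaussMoment p)) ^ 2) P ∧
    ∫ ω, (∫ x in shiftDomain s,
      (|normIncrement (fun x ω => V (x, ω)) t s x ω| ^ p - gaussMoment p)) ^ 2 ∂P ≤
      covConst p * (2 * M + 2) * s := by
  have := hW.isGaussianProcess.isProbabilityMeasure
  have hp0 : 0 < p := by linarith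
  set m := gaussMoment p
  set μ := volume.restrict (shiftDomain s) with hμ
  have hcov : s / 2 ≤ incrementCov t s 0 := by
    have h1 := (abs_le.1 h0).1
    nlinarith
  have hpos : 0 < incrementCov t s 0 := by linarith
  let ξ : ℝ × Ω → ℝ := fun q => normIncrement (fun x ω => V (x, ω)) t s q.1 q.2
  have hξ : Measurable ξ := by
    have : Measurable fun q : ℝ × Ω =>
      (√(incrementCov t s 0))⁻¹ * (V (q.1 + s, q.2) - V (q.1, q.2)) := by fun_prop
    exact this
  have hUV' : ∀ᵐ x, ∀ᵐ ω ∂P, U (x + s) ω = V (x + s, ω) :=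
    (measurePreserving_add_right volume s).quasiMeasurePreserving.ae hUV
  have hξU : ∀ᵐ x ∂μ, normIncrement U t s x =ᵐ[P] fun ω => ξ (x, ω) := by
    refine ae_restrict_of_ae ?_
    filter_upwards [hUV, hUV'] with x hx hx'
    filter_upwards [hx, hx'] with ω h1 h2
    simp only [ξ, normIncrement, h1, h2]
  have hlaw : ∀ᵐ x ∂μ, P.map (fun ω => ξ (x, ω)) = gaussianReal 0 1 := by
    filter_upwards [hξU] with x hx
    rw [← map_normIncrement hW hU ht.le hpos x]
    exact (Measure.map_congr hx).symm
  let Φ : ℝ × Ω → ℝ := fun q => |ξ q| ^ p - m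
  have hΦ : Measurable Φ := by fun_prop
  have hΦ2 : Integrable (fun q => Φ q ^ 2) (μ.prod P) :=
    integrable_comp_of_map_eq hξ hlaw (F := fun z => (|z| ^ p - m) ^ 2) (by fun_prop)
      (integrable_centered_sq hp0 m)
  have hC := covConst_nonneg hp
  obtain ⟨hBi, hBle⟩ := integral_near_diagonal_le (c := covConst p * (2 * M * s))
    (d := covConst p) hs.le hs1 (by positivity) hC
  have hB : ∀ᵐ q ∂μ.prod μ, |∫ ω, Φ (q.1, ω) * Φ (q.2, ω) ∂P| ≤ covConst p * (2 * M * s) +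
      {q : ℝ × ℝ | |q.2 - q.1| < s}.indicator (fun _ => covConst p) q := by
    have h1 : ∀ᵐ q ∂μ.prod μ, normIncrement U t s q.1 =ᵐ[P] fun ω => ξ (q.1, ω) :=
      Measure.quasiMeasurePreserving_fst.ae hξU
    have h2 : ∀ᵐ q ∂μ.prod μ, normIncrement U t s q.2 =ᵐ[P] fun ω => ξ (q.2, ω) :=
      Measure.quasiMeasurePreserving_snd.ae hξU
    filter_upwards [h1, h2] with q hq1 hq2
    have e : ∫ ω, Φ (q.1, ω) * Φ (q.2, ω) ∂P = ∫ ω, (|normIncrement U t s q.1 ω| ^ p - m) *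
        (|normIncrement U t s q.2 ω| ^ p - m) ∂P := by
      refine integral_congr_ae ?_
      filter_upwards [hq1, hq2] with ω h3 h4
      simp only [Φ, h3, h4]
    obtain ⟨hρ, hle⟩ := abs_integral_normIncrement_le hW hU ht.le hpos hp q.1 q.2
    rw [e]
    refine hle.trans ?_
    by_cases hq : |q.2 - q.1| < s
    · rw [indicator_of_mem (by exact hq)]
      have := mul_le_mul_of_nonneg_left hρ hC
      have : 0 ≤ covConst p * (2 * M * s) := by positivity
      linarith
    · rw [indicator_of_notMem (by exact hq), add_zero]
      refine mul_le_mul_of_nonneg_left ?_ hC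
      -- Off the diagonal the correlation is at most M s² / (s / 2) = 2 M s.
      rw [incrementCorr, abs_div, abs_of_pos hpos, div_le_iff₀ hpos]
      refine (hfar _ (not_lt.1 hq)).trans ?_
      have := mul_le_mul_of_nonneg_left hcov (by positivity : 0 ≤ 2 * M * s)
      linarith
  obtain ⟨r1, r2⟩ := integral_sq_integral_le hΦ hΦ2 hBi hB
  refine ⟨?_, r1, r2.trans (hBle.trans_eq (by ring))⟩
  exact integrable_comp_of_map_eq hξ hlaw (F := fun z => |z| ^ p) (by fun_prop)
    (integrable_abs_rpow_gaussianReal hp0)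

end Path

/-- The scalar σ comes out of the norm, and integrability turns the extended norm into the power of
a real integral, to which limits apply. -/
lemma shiftNorm_eq_of_integrable {f : ℝ → ℝ} (hf : Measurable f) {p s σ : ℝ} (hp : 0 < p)
    (hσ : 0 < σ)
    (hi : Integrable (fun x => |σ⁻¹ * (f (x + s) - f x)| ^ p) (volume.restrict (shiftDomain s))) :
    shiftNorm (ENNReal.ofReal p) f s =
      ENNReal.ofReal (σ * (∫ x in shiftDomain s, |σ⁻¹ * (f (x + s) - f x)| ^ p) ^ p⁻¹) := by
  have hp0 : ENNReal.ofReal p ≠ 0 := by simpa using hp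
  set g : ℝ → ℝ := fun x => σ⁻¹ * (f (x + s) - f x) with hg
  have hgm : Measurable g := by fun_prop
  have hgL : MemLp g (ENNReal.ofReal p) (volume.restrict (shiftDomain s)) := by
    rw [← integrable_norm_rpow_iff hgm.aestronglyMeasurable hp0 ENNReal.ofReal_ne_top,
      ENNReal.toReal_ofReal hp.le]
    exact hi
  have e : (fun x => f (x + s) - f x) = σ • g := by
    ext x
    simp [hg, hσ.ne']
  rw [shiftNorm, e, eLpNorm_const_smul, hgL.eLpNorm_eq_integral_rpow_norm hp0 ENNReal.ofReal_ne_top,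
    ENNReal.toReal_ofReal hp.le, ENNReal.ofReal_mul hσ.le, Real.enorm_of_nonneg hσ.le]
  simp only [Real.norm_eq_abs, hg]

/-- Two-sided bounds for the increments of a function over dyadic steps, from the convergence of its
normalized `p`-th power variations. -/
lemma exists_dyadic_bounds {f : ℝ → ℝ} (hf : Measurable f) {p m : ℝ} (hp : 0 < p) (hm : 0 < m)
    {σ : ℕ → ℝ} {n₀ : ℕ} (hσ0 : ∀ n, 0 < σ n)
    (hσ1 : ∀ n, (1 / 2 : ℝ) ^ (n + n₀) / 2 ≤ σ n ^ 2)
    (hσ2 : ∀ n, σ n ^ 2 ≤ 2 * (1 / 2 : ℝ) ^ (n + n₀))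
    (hi : ∀ n, Integrable (fun x => |(σ n)⁻¹ * (f (x + (1 / 2) ^ (n + n₀)) - f x)| ^ p)
      (volume.restrict (shiftDomain ((1 / 2) ^ (n + n₀)))))
    (hlim : Tendsto (fun n => ∫ x in shiftDomain ((1 / 2) ^ (n + n₀)),
      |(σ n)⁻¹ * (f (x + (1 / 2) ^ (n + n₀)) - f x)| ^ p) atTop (𝓝 m)) :
    ∃ (c C : ℝ≥0∞) (N : ℕ), c ≠ 0 ∧ C ≠ ∞ ∧ ∀ n ≥ N,
      c * ENNReal.ofReal (((1 / 2 : ℝ) ^ n) ^ (1 / 2 : ℝ)) ≤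
        shiftNorm (ENNReal.ofReal p) f ((1 / 2) ^ n) ∧
      shiftNorm (ENNReal.ofReal p) f ((1 / 2) ^ n) ≤
        C * ENNReal.ofReal (((1 / 2 : ℝ) ^ n) ^ (1 / 2 : ℝ)) := by
  -- Any window around m bounded away from 0 and ∞ would serve.
  have hev := hlim.eventually (Ioo_mem_nhds (half_lt_self hm) (lt_two_mul_self hm))
  obtain ⟨N, hN⟩ := eventually_atTop.1 hev
  have hc : 0 < √(1 / 2) * (m / 2) ^ p⁻¹ := by positivity
  refine ⟨ENNReal.ofReal (√(1 / 2) * (m / 2) ^ p⁻¹), ENNReal.ofReal (√2 * (2 * m) ^ p⁻¹), N + n₀,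
    by simpa using hc, ENNReal.ofReal_ne_top, fun k hk => ?_⟩
  obtain ⟨n, rfl⟩ : ∃ n, k = n + n₀ := ⟨k - n₀, by omega⟩
  obtain ⟨h1, h2⟩ := hN n (by omega)
  rw [shiftNorm_eq_of_integrable hf hp (hσ0 n) (hi n), ← ENNReal.ofReal_mul hc.le,
    ← ENNReal.ofReal_mul (by positivity), ← Real.sqrt_eq_rpow]
  set J := ∫ x in shiftDomain ((1 / 2) ^ (n + n₀)),
      |(σ n)⁻¹ * (f (x + (1 / 2) ^ (n + n₀)) - f x)| ^ p
  have hp' : 0 ≤ p⁻¹ := by positivity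
  have hJ1 : (m / 2) ^ p⁻¹ ≤ J ^ p⁻¹ := Real.rpow_le_rpow (by positivity) h1.le hp'
  have hJ2 : J ^ p⁻¹ ≤ (2 * m) ^ p⁻¹ := Real.rpow_le_rpow (by linarith) h2.le hp'
  have hs1 : √(1 / 2) * √((1 / 2) ^ (n + n₀)) ≤ σ n := by
    rw [← Real.sqrt_mul (by norm_num)]
    exact Real.sqrt_le_iff.2 ⟨(hσ0 n).le, by linarith [hσ1 n]⟩
  have hs2 : σ n ≤ √2 * √((1 / 2) ^ (n + n₀)) := by
    rw [← Real.sqrt_mul (by norm_num)]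
    exact Real.le_sqrt_of_sq_le (hσ2 n)
  constructor
  · refine ENNReal.ofReal_le_ofReal ?_
    rw [mul_right_comm]
    exact mul_le_mul hs1 hJ1 (by positivity) (hσ0 n).le
  · refine ENNReal.ofReal_le_ofReal ?_
    rw [mul_right_comm]
    exact mul_le_mul hs2 hJ2 (Real.rpow_nonneg (by linarith) _) (by positivity)

/-! ### Almost sure dyadic bounds for the paths, and the conclusion. -/

section Solution

variable {Ω : Type*} [MeasurableSpace Ω] {P : Measure Ω} {W : ℝ≥0 × BoundedBorel → Ω → ℝ}
  {t : ℝ} {U : ℝ → Ω → ℝ}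

/-- The paths of a measurable version of the mild solution at time `t` have finite moments. -/
lemma ae_memLp_path (hW : IsWhiteNoise W P) (ht : 0 ≤ t)
    (hU : ∀ x, IsWienerIntegral W P (mildKernel t x) (U x)) {V : ℝ × Ω → ℝ} (hV : Measurable V)
    (hUV : ∀ᵐ x, ∀ᵐ ω ∂P, U x ω = V (x, ω)) {p : ℝ} (hp : 0 < p) :
    ∀ᵐ ω ∂P, MemLp (fun x => V (x, ω)) (ENNReal.ofReal p) (volume.restrict (Icc 0 1)) := by
  have := hW.isGaussianProcess.isProbabilityMeasure
  have hp0 : ENNReal.ofReal p ≠ 0 := by simpa using hp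
  have hlaw : ∀ᵐ x ∂volume.restrict (Icc (0 : ℝ) 1), P.map (fun ω => V (x, ω)) =
      gaussianReal 0 (greenPotential t 0).toNNReal := by
    refine ae_restrict_of_ae ?_
    filter_upwards [hUV] with x hx
    have h1 := (hU x).map_eq hW
    simp only [sq] at h1
    rw [integral_mildKernel_mul ht (hU x).1 (hU x).1, sub_self] at h1
    rw [← h1]
    exact (Measure.map_congr hx).symm
  have hint : Integrable (fun z => |z| ^ p) (gaussianReal 0 (greenPotential t 0).toNNReal) := by
    have h := (memLp_id_gaussianReal' (μ := 0) (v := (greenPotential t 0).toNNReal)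
      (ENNReal.ofReal p) ENNReal.ofReal_ne_top).integrable_norm_rpow hp0 ENNReal.ofReal_ne_top
    simpa [ENNReal.toReal_ofReal hp.le] using h
  have h := integrable_comp_of_map_eq hV hlaw (F := fun z => |z| ^ p) (by fun_prop) hint
  filter_upwards [h.prod_left_ae] with ω hω
  rw [← integrable_norm_rpow_iff (by fun_prop : Measurable fun x => V (x, ω)).aestronglyMeasurable
    hp0 ENNReal.ofReal_ne_top, ENNReal.toReal_ofReal hp.le]
  exact hω

/-- The increments of almost every path of the mild solution over dyadic steps `s` are of exact
order `s ^ (1 / 2)` in `L^p`. -/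
theorem ae_exists_dyadic_bounds (hW : IsWhiteNoise W P) (ht : 0 < t)
    (hU : ∀ x, IsWienerIntegral W P (mildKernel t x) (U x)) {V : ℝ × Ω → ℝ} (hV : Measurable V)
    (hUV : ∀ᵐ x, ∀ᵐ ω ∂P, U x ω = V (x, ω)) {p : ℝ} (hp : 1 ≤ p) :
    ∀ᵐ ω ∂P, ∃ (c C : ℝ≥0∞) (N : ℕ), c ≠ 0 ∧ C ≠ ∞ ∧ ∀ n ≥ N,
      c * ENNReal.ofReal (((1 / 2 : ℝ) ^ n) ^ (1 / 2 : ℝ)) ≤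
        shiftNorm (ENNReal.ofReal p) (fun x => V (x, ω)) ((1 / 2) ^ n) ∧
      shiftNorm (ENNReal.ofReal p) (fun x => V (x, ω)) ((1 / 2) ^ n) ≤
        C * ENNReal.ofReal (((1 / 2 : ℝ) ^ n) ^ (1 / 2 : ℝ)) := by
  have := hW.isGaussianProcess.isProbabilityMeasure
  have hp0 : 0 < p := by linarith
  obtain ⟨M, hM, hcov⟩ := exists_incrementCov_bound ht
  -- Starting at n₀ forces M s ≤ 1/2, which keeps the variance of the increments between s / 2 and 2
  -- s.
  obtain ⟨n₀, hn₀⟩ := exists_pow_lt_of_lt_one (show 0 < 1 / (2 * M) by positivity)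
    (show (1 / 2 : ℝ) < 1 by norm_num)
  set s : ℕ → ℝ := fun n => (1 / 2) ^ (n + n₀) with hs
  have hs0 : ∀ n, 0 < s n := fun n => by positivity
  have hs1 : ∀ n, s n ≤ 1 := fun n => pow_le_one₀ (by norm_num) (by norm_num)
  have hMs : ∀ n, M * s n ≤ 1 / 2 := fun n => by
    have h1 : s n ≤ 1 / (2 * M) :=
      (pow_le_pow_of_le_one (by norm_num) (by norm_num) (Nat.le_add_left n₀ n)).trans hn₀.le
    calc M * s n ≤ M * (1 / (2 * M)) := by gcongr
      _ = 1 / 2 := by field_simp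
  have hσ : ∀ n, s n / 2 ≤ incrementCov t (s n) 0 ∧ incrementCov t (s n) 0 ≤ 2 * s n := fun n => by
    have h1 := abs_le.1 (hcov (s n) (hs0 n)).1
    have h2 := mul_le_mul_of_nonneg_right (hMs n) (hs0 n).le
    constructor <;> nlinarith [h1.1, h1.2, hs0 n]
  have hpos : ∀ n, 0 < incrementCov t (s n) 0 := fun n => by linarith [(hσ n).1, hs0 n]
  have key := fun n => integral_sq_centered_power_variation_le hW ht hU hV hUV hp hM (hs0 n)
    (hs1 n) (hMs n) (hcov (s n) (hs0 n)).1 (hcov (s n) (hs0 n)).2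
  set ξ : ℕ → ℝ → Ω → ℝ := fun n => normIncrement (fun x ω => V (x, ω)) t (s n) with hξ
  have hξm : ∀ n, Measurable fun q : ℝ × Ω => ξ n q.1 q.2 := fun n => by
    simp only [hξ, normIncrement]
    fun_prop
  have hslim : Tendsto s atTop (𝓝 0) :=
    (tendsto_pow_atTop_nhds_zero_of_lt_one (by norm_num) (by norm_num)).comp
      (tendsto_add_atTop_nat n₀)
  have hsum : Summable fun n => covConst p * (2 * M + 2) * s n :=
    ((summable_nat_add_iff n₀).2 (summable_geometric_of_lt_one (by norm_num)
      (by norm_num : (1 / 2 : ℝ) < 1))).mul_left _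
  have hlim := ae_tendsto_zero_of_summable_integral_sq
    (X := fun n ω => ∫ x in shiftDomain (s n), (|ξ n x ω| ^ p - gaussMoment p))
    (fun n => (key n).2.1) (fun n => by
      have h : StronglyMeasurable fun q : Ω × ℝ => |ξ n q.2 q.1| ^ p - gaussMoment p :=
        (((hξm n).comp measurable_swap).abs.pow_const p |>.sub_const _).stronglyMeasurable
      exact h.integral_prod_right.measurable.aemeasurable) hsum (fun n => (key n).2.2)
  filter_upwards [hlim, ae_all_iff.2 fun n => (key n).1.prod_left_ae] with ω hω hωi
  refine exists_dyadic_bounds (by fun_prop) hp0 (gaussMoment_pos hp0) (n₀ := n₀)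
    (σ := fun n => √(incrementCov t (s n) 0)) (fun n => Real.sqrt_pos.2 (hpos n))
    (fun n => by rw [Real.sq_sqrt (hpos n).le]; exact (hσ n).1)
    (fun n => by rw [Real.sq_sqrt (hpos n).le]; exact (hσ n).2) hωi ?_
  -- The centering was integrated over a domain of length 1 - s, so (1 - s) m is added back; it
  -- tends to m.
  have h1 := hω.add ((hslim.const_sub 1).mul_const (gaussMoment p))
  simp only [sub_zero, one_mul, zero_add] at h1
  refine h1.congr fun n => ?_
  rw [integral_sub (hωi n) (integrable_const _), integral_const,
    measureReal_restrict_apply MeasurableSet.univ, univ_inter,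
    volume_real_shiftDomain (hs0 n).le (hs1 n), smul_eq_mul, sub_add_cancel]
  rfl

end Solution

end StochHeat

open StochHeat

theorem theorem2p3 {Ω : Type*} [MeasurableSpace Ω] (P : Measure Ω) [IsProbabilityMeasure P]
    (W : ℝ≥0 × StochHeat.BoundedBorel → Ω → ℝ) (hW : StochHeat.IsWhiteNoise W P)
    (T : ℝ) (u : ℝ → ℝ → Ω → ℝ) (hu : StochHeat.IsMildSolution W P T u)
    (t : ℝ) (ht : t ∈ Ioc 0 T) (p : ℝ) (hp : 2 < p) :
    (∀ᵐ ω ∂P, (fun x => u t x ω) ∈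
      StochHeat.besov (1 / 2) (ENNReal.ofReal p) (Icc 0 1)) ∧
    (∀ᵐ ω ∂P, (fun x => u t x ω) ∉
      StochHeat.littleBesov (1 / 2) (ENNReal.ofReal p) (Icc 0 1)) := by
  have htT : t ∈ Icc 0 T := ⟨ht.1.le, ht.2⟩
  have hU := hu.isWienerIntegral t htT
  obtain ⟨V, hV, huV⟩ := hu.aemeasurable t htT
  -- Fubini is used in both orders: the laws are known for almost every x, whereas path properties
  -- need almost every ω.
  have hUV : ∀ᵐ x, ∀ᵐ ω ∂P, u t x ω = V (x, ω) := Measure.ae_ae_of_ae_prod huV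
  have hVU : ∀ᵐ ω ∂P, ∀ᵐ x, u t x ω = V (x, ω) :=
    Measure.ae_ae_of_ae_prod (Measure.measurePreserving_swap.quasiMeasurePreserving.ae huV)
  have hq : 1 ≤ ENNReal.ofReal p := ENNReal.one_le_ofReal.2 (by linarith)
  rw [← eventually_and]
  filter_upwards [hVU, ae_memLp_path hW ht.1.le hU hV hUV (by linarith : 0 < p),
    ae_exists_dyadic_bounds hW ht.1 hU hV hUV (by linarith : 1 ≤ p)] with ω hω hL hb
  obtain ⟨c, C, N, hc, hC, h⟩ := hb
  have hω' := ae_restrict_of_ae (s := Icc (0 : ℝ) 1) hω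
  simp only [← shiftNorm_congr (f := fun x => u t x ω) hω'] at h
  exact ⟨mem_besov_of_dyadic hq ENNReal.ofReal_ne_top (hL.ae_eq (hω'.mono fun x hx => hx.symm)) hC
    fun n hn => (h n hn).2, notMem_littleBesov_of_dyadic hc fun n hn => (h n hn).1⟩
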